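/- Let $\beta>0$ and let $U_\beta(t)$, $0\le t\le 1$, be the (stationary) Ornstein–Uhlenbeck process, i.e. a measurable zero-mean Gaussian process on $[0,1]$ with covariance $\mathbb{E}\,U_\beta(t)U_\beta(s)=\frac{1}{2\beta}\exp(-\beta|t-s|)$. Let $\overline{U_\beta}(t)=U_\beta(t)-\int_0^1U_\beta(s)\,ds$ be the demeaned process, and let $\|X\|=\big(\int_0^1 X(t)^2\,dt\big)^{1/2}$ denote the norm in $L_2[0,1]$. Then $$ \mathbb{P}\big\{\|\overline{U_\beta}\|\le\varepsilon\big\}\sim\Big(\frac{16\,e^{\beta}}{\pi(2+\beta)}\Big)^{1/2}\exp\Big(-\frac18\,\varepsilon^{-2}\Big),\qquad \varepsilon\to0^+, $$ that is, the ratio of the two sides tends to $1$. -/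

import Mathlib

open MeasureTheory ProbabilityTheory Filter Topology Asymptotics
open scoped unitInterval

/-- `U` is an Ornstein-Uhlenbeck process on `[0,1]` with parameter `β`: a (measurable) zero-mean
Gaussian process with `𝔼 U(t) U(s) = exp (-β |t - s|) / (2 β)`. The measurability requirement
is up to null sets of (Lebesgue measure on `[0,1]`) × `P`; it makes the integrals of the sample
paths meaningful, and holds in particular for every version with continuous paths. -/
structure IsOrnsteinUhlenbeck {Ω : Type*} [MeasurableSpace Ω] (β : ℝ) (U : I → Ω → ℝ)
    (P : Measure Ω) : Prop where
  isGaussianProcess : IsGaussianProcess U P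
  aemeasurable_uncurry :
    AEMeasurable (Function.uncurry U) ((volume : Measure I).prod P)
  mean_zero : ∀ t : I, ∫ ω, U t ω ∂P = 0
  covariance : ∀ t s : I,
    ∫ ω, U t ω * U s ω ∂P = 1 / (2 * β) * Real.exp (-β * |(t : ℝ) - (s : ℝ)|)

/-- The demeaned process `X(t) - ∫₀¹ X(s) ds`. -/
noncomputable def demeaned {Ω : Type*} (X : I → Ω → ℝ) : I → Ω → ℝ :=
  fun t ω => X t ω - ∫ s : I, X s ω

/-- The norm in `L₂[0,1]` of the sample path of `X` at `ω`, as an extended nonnegative real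
(it is `∞` when the path is not square integrable). -/
noncomputable def pathNorm {Ω : Type*} (X : I → Ω → ℝ) (ω : Ω) : ENNReal :=
  eLpNorm (fun t : I => X t ω) 2 volume

/-! The squared norm `S` of the demeaned path is the variance of the path under the uniform law on
`[0,1]`. The proof computes the Laplace transform of `S` exactly and inverts it by the saddle point
method.

Transform: for the step process that samples `U` at the points `k/n`, `S` becomes a quadratic form
of a Gaussian vector, so the squared transform is the inverse of a finite determinant
(`integral_exp_variance_sampled`). The covariance matrix is `ρ^|i-j|` up to a factor, its
determinants obey a two-term recurrence, and centering is a rank-one correction governed by an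
explicit linear system. With suitably tuned weights these closed forms converge (`exists_weights`).
The variance of the sampled path is `L¹`-close to that of the path, which yields `laplace_variance`:
`(𝔼 exp(-s S))² * D(γ) = 1` with `γ = √(2s + β²)` and `D` the function `fredholmDet`.

Inversion: by analytic continuation the identity holds for `Re z > 0`. For large `Re z` and `p =
√(2z)` it gives `L(z) ~ C √p exp(-p/2)` with `C² = 4 e^β / (2 + β)` (`tendsto_fredholmDet_inv`,
`tendsto_normalized`). In the Bromwich integral for `P(S ≤ x)` the exponent `z x - √(2z)/2` has its
saddle where `√(2z) = 1/(2x)`. With `x = ε²` this is `p = 1/(2ε²)`, the critical value is `-p/4 =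
-1/(8ε²)`, and the Gaussian integral across the saddle contributes the factor `2C/√π`
(`bromwich_asymptotics`). -/

namespace LaplaceInversion

/-! ### Bromwich inversion of a distribution function. -/

lemma integrableOn_mul_exp_neg {c : ℝ} (hc : 0 < c) :
    IntegrableOn (fun x : ℝ => x * Real.exp (-c * x)) (Set.Ioi 0) := by
  have := integrableOn_rpow_mul_exp_neg_mul_rpow (p := 1) (s := 1) (b := c) (by norm_num) one_pos hc
  simpa using this

lemma integrable_max_mul_exp_neg {c : ℝ} (hc : 0 < c) :
    Integrable (fun x : ℝ => max x 0 * Real.exp (-c * x)) := by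
  have h := (integrableOn_mul_exp_neg hc).integrable_indicator measurableSet_Ioi
  refine h.congr (Eventually.of_forall fun x => ?_)
  by_cases hx : 0 < x
  · simp [Set.indicator, hx, hx.le]
  · simp [Set.indicator, hx, not_lt.mp hx]

lemma integral_Ioi_mul_cexp_neg {r : ℂ} (hr : 0 < r.re) :
    ∫ x : ℝ in Set.Ioi 0, (x : ℂ) * Complex.exp (-r * x) = 1 / r ^ 2 := by
  have hr0 : r ≠ 0 := fun h => by simp [h] at hr
  have hderiv : ∀ x ∈ Set.Ici (0 : ℝ),
      HasDerivAt (fun x : ℝ => -((x : ℂ) / r + 1 / r ^ 2) * Complex.exp (-r * x))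
        ((x : ℂ) * Complex.exp (-r * x)) x := by
    intro x _
    have h1 : HasDerivAt (fun x : ℝ => (x : ℂ)) 1 x := Complex.ofRealCLM.hasDerivAt
    have h2 := ((h1.div_const r).add_const (1 / r ^ 2)).neg.mul ((h1.const_mul (-r)).cexp)
    refine h2.congr_deriv ?_
    simp only [Pi.neg_apply]
    field_simp
    ring
  have hn : ∀ x : ℝ, ‖Complex.exp (-r * x)‖ = Real.exp (-r.re * x) := by
    intro x; rw [Complex.norm_exp]; simp
  have hint : IntegrableOn (fun x : ℝ => (x : ℂ) * Complex.exp (-r * x)) (Set.Ioi 0) := by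
    refine (integrableOn_mul_exp_neg hr).mono' (by fun_prop) ?_
    refine (ae_restrict_iff' measurableSet_Ioi).2 (Eventually.of_forall fun x hx => ?_)
    rw [norm_mul, hn, Complex.norm_real, Real.norm_of_nonneg (le_of_lt hx)]
  have hlim : Tendsto (fun x : ℝ => -((x : ℂ) / r + 1 / r ^ 2) * Complex.exp (-r * x)) atTop
      (𝓝 0) := by
    rw [tendsto_zero_iff_norm_tendsto_zero]
    have e1 : Tendsto (fun x : ℝ => x ^ 1 * Real.exp (-r.re * x)) atTop (𝓝 0) := by
      have := Real.tendsto_pow_mul_exp_neg_atTop_nhds_zero 1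
      have h2 := (this.comp (tendsto_id.const_mul_atTop hr)).const_mul (1 / r.re)
      simp only [mul_zero] at h2
      refine h2.congr fun x => ?_
      simp only [Function.comp, id]
      field_simp
    have e0 : Tendsto (fun x : ℝ => Real.exp (-r.re * x)) atTop (𝓝 0) := by
      refine Real.tendsto_exp_atBot.comp ?_
      exact (tendsto_id.const_mul_atTop_of_neg (by linarith))
    have e2 := (e1.const_mul (1 / ‖r‖)).add (e0.const_mul (1 / ‖r‖ ^ 2))
    simp only [mul_zero, add_zero] at e2
    refine squeeze_zero' (Eventually.of_forall fun _ => norm_nonneg _) ?_ e2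
    filter_upwards [eventually_ge_atTop (0 : ℝ)] with x hx
    rw [norm_mul, norm_neg, hn]
    have : ‖(x : ℂ) / r + 1 / r ^ 2‖ ≤ x / ‖r‖ + 1 / ‖r‖ ^ 2 := by
      refine (norm_add_le _ _).trans ?_
      simp [abs_of_nonneg hx]
    calc _ ≤ (x / ‖r‖ + 1 / ‖r‖ ^ 2) * Real.exp (-r.re * x) := by gcongr
      _ = _ := by ring
  have := integral_Ioi_of_hasDerivAt_of_tendsto' hderiv hint hlim
  rw [this]
  simp

/-- This integrability is the reason for inverting the ramp first: the transform `1/z` of a step is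
not absolutely integrable on a vertical line, while `1/z²` is. -/
lemma integrable_inv_sq_line {c : ℝ} (hc : 0 < c) :
    Integrable (fun y : ℝ => 1 / ((c : ℂ) + y * Complex.I) ^ 2) := by
  have h := (integrable_inv_one_add_sq.const_mul (max 1 (1 / c ^ 2)))
  have hne : ∀ y : ℝ, (c : ℂ) + y * Complex.I ≠ 0 := fun y h => by
    have := congrArg Complex.re h
    simp at this; linarith
  refine h.mono' ?_ (Eventually.of_forall fun y => ?_)
  · exact (Continuous.div (by fun_prop) (by fun_prop)
      (fun y => pow_ne_zero _ (hne y))).aestronglyMeasurable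
  · have hn : ‖(c : ℂ) + y * Complex.I‖ ^ 2 = c ^ 2 + y ^ 2 := by
      rw [← Complex.normSq_eq_norm_sq, Complex.normSq_add_mul_I]
    rw [norm_div, norm_pow, hn, norm_one, div_le_iff₀ (by positivity)]
    rw [mul_assoc, ← div_eq_inv_mul]
    have h1 : (1 : ℝ) ≤ max 1 (1 / c ^ 2) := le_max_left _ _
    have h2 : 1 / c ^ 2 ≤ max 1 (1 / c ^ 2) := le_max_right _ _
    rw [div_le_iff₀ (by positivity)] at h2
    rw [← mul_div_assoc, le_div_iff₀ (by positivity)]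
    nlinarith [sq_nonneg y]

/-- The Bromwich integral of the Laplace transform of the ramp function. -/
lemma integral_line_ramp {c : ℝ} (hc : 0 < c) (x : ℝ) :
    ∫ y : ℝ, Complex.exp (((c : ℂ) + y * Complex.I) * x) / ((c : ℂ) + y * Complex.I) ^ 2
      = 2 * Real.pi * (max x 0 : ℝ) := by
  -- The damped ramp is continuous and integrable, and its Fourier transform is `1/(c + 2πiξ)²`, so
  -- Fourier inversion applies pointwise. Multiplying by `exp(cx)` undoes the damping.
  set f : ℝ → ℂ := fun x => ((max x 0 * Real.exp (-c * x) : ℝ) : ℂ) with hf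
  have hfc : Continuous f := by fun_prop
  have hfi : Integrable f := (integrable_max_mul_exp_neg hc).ofReal
  have hF : FourierTransform.fourier f
      = fun ξ : ℝ => 1 / ((c : ℂ) + (2 * Real.pi * ξ : ℝ) * Complex.I) ^ 2 := by
    ext ξ
    rw [Real.fourier_eq']
    have hr : 0 < ((c : ℂ) + (2 * Real.pi * ξ : ℝ) * Complex.I).re := by simpa using hc
    rw [← integral_Ioi_mul_cexp_neg hr, ← integral_indicator measurableSet_Ioi]
    congr 1
    ext v
    by_cases hv : 0 < v
    · simp only [hf, Set.indicator, Set.mem_Ioi, hv, if_true, max_eq_left hv.le, smul_eq_mul]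
      push_cast
      rw [mul_left_comm, ← Complex.exp_add]
      congr 2
      simp
      ring
    · simp [hf, Set.indicator, hv, not_lt.mp hv]
  have hFi : Integrable (FourierTransform.fourier f) := by
    rw [hF]
    exact (integrable_inv_sq_line hc).comp_mul_left' (R := 2 * Real.pi) (by positivity)
  have inv := congrFun (hfc.fourierInv_fourier_eq hfi hFi) x
  rw [Real.fourierInv_eq', hF] at inv
  have hsub := Measure.integral_comp_mul_left (fun y : ℝ =>
    Complex.exp (((c : ℂ) + y * Complex.I) * x) / ((c : ℂ) + y * Complex.I) ^ 2) (2 * Real.pi)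
  have hpi : (0 : ℝ) < 2 * Real.pi := by positivity
  rw [abs_of_pos (inv_pos.2 hpi)] at hsub
  have : ∫ y : ℝ, Complex.exp (((c : ℂ) + y * Complex.I) * x) / ((c : ℂ) + y * Complex.I) ^ 2
      = (2 * Real.pi : ℝ) • ∫ (v : ℝ), Complex.exp (((c : ℂ) + (2 * Real.pi * v : ℝ) * Complex.I) * x)
        / ((c : ℂ) + (2 * Real.pi * v : ℝ) * Complex.I) ^ 2 := by
    rw [hsub, smul_smul, mul_inv_cancel₀ hpi.ne', one_smul]
  rw [this]
  have e : ∀ v : ℝ, Complex.exp (((c : ℂ) + (2 * Real.pi * v : ℝ) * Complex.I) * x)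
        / ((c : ℂ) + (2 * Real.pi * v : ℝ) * Complex.I) ^ 2 = Complex.exp (c * x) *
        (Complex.exp (↑(2 * Real.pi * inner ℝ v x) * Complex.I) •
          (1 / ((c : ℂ) + (2 * Real.pi * v : ℝ) * Complex.I) ^ 2)) := by
    intro v
    rw [smul_eq_mul, ← mul_assoc, ← Complex.exp_add, mul_one_div]
    congr 2
    simp
    ring
  simp_rw [e]
  rw [integral_const_mul, inv]
  simp only [hf]
  push_cast
  rw [Complex.real_smul]
  have h3 : Complex.exp (c * x) * Complex.exp (-c * x) = 1 := by
    rw [← Complex.exp_add]; simp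
  push_cast
  linear_combination (2 * Real.pi * max x 0 : ℂ) * h3

variable {Ω : Type*} [MeasurableSpace Ω] {P : Measure Ω} {S : Ω → ℝ}

lemma norm_cexp_neg_le_one (hS0 : ∀ᵐ ω ∂P, 0 ≤ S ω) {z : ℂ} (hz : 0 ≤ z.re) :
    ∀ᵐ ω ∂P, ‖Complex.exp (-z * S ω)‖ ≤ 1 := by
  filter_upwards [hS0] with ω hω
  rw [Complex.norm_exp]
  simp only [Complex.neg_re, Complex.re_mul_ofReal, Real.exp_le_one_iff,
    neg_nonpos, neg_mul]
  positivity

variable [IsProbabilityMeasure P]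

lemma integrable_cexp_neg (hS : AEMeasurable S P) (hS0 : ∀ᵐ ω ∂P, 0 ≤ S ω) {z : ℂ}
    (hz : 0 ≤ z.re) : Integrable (fun ω => Complex.exp (-z * S ω)) P := by
  refine (integrable_const (1 : ℝ)).mono' ?_ (norm_cexp_neg_le_one hS0 hz)
  exact (Complex.measurable_exp.comp_aemeasurable
    ((Complex.measurable_ofReal.comp_aemeasurable hS).const_mul (-z))).aestronglyMeasurable

/-- Laplace inversion for the expected ramp. -/
lemma integral_ramp_eq (hS : AEMeasurable S P) (hS0 : ∀ᵐ ω ∂P, 0 ≤ S ω) {c : ℝ} (hc : 0 < c)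
    (x : ℝ) :
    2 * Real.pi * ((∫ ω, max (x - S ω) 0 ∂P : ℝ) : ℂ) =
      ∫ y : ℝ, Complex.exp (((c : ℂ) + y * Complex.I) * x) *
        (complexMGF S P (-((c : ℂ) + y * Complex.I)) / ((c : ℂ) + y * Complex.I) ^ 2) := by
  rw [← integral_complex_ofReal, ← integral_const_mul]
  simp_rw [← integral_line_ramp hc]
  rw [integral_integral_swap]
  · congr 1
    ext y
    rw [complexMGF, ← integral_div, ← integral_const_mul]
    congr 1
    ext ω
    rw [← mul_div_assoc, ← Complex.exp_add]
    congr 2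
    push_cast; ring
  · have h1 : Integrable (fun q : Ω × ℝ => Real.exp (c * x) *
        ‖1 / ((c : ℂ) + q.2 * Complex.I) ^ 2‖) (P.prod volume) :=
      (((integrable_inv_sq_line hc).norm.comp_snd P)).const_mul _
    refine h1.mono' ?_ ?_
    · have hm : AEMeasurable (fun q : Ω × ℝ => S q.1) (P.prod volume) := hS.comp_fst
      refine AEMeasurable.aestronglyMeasurable ?_
      simp only [Function.uncurry_def]
      fun_prop
    · have : ∀ᵐ q ∂(P.prod (volume : Measure ℝ)), 0 ≤ S q.1 :=
        Measure.quasiMeasurePreserving_fst.ae hS0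
      filter_upwards [this] with q hq
      simp only [Function.uncurry_def]
      rw [norm_div, norm_div, norm_one, ← mul_div_assoc, mul_one]
      gcongr
      rw [Complex.norm_exp]
      simp
      nlinarith

lemma line_ne_zero {c : ℝ} (hc : 0 < c) (y : ℝ) : (c : ℂ) + y * Complex.I ≠ 0 := fun h => by
  have := congrArg Complex.re h
  simp at this; linarith

lemma continuous_complexMGF_line (hS : AEMeasurable S P) (hS0 : ∀ᵐ ω ∂P, 0 ≤ S ω) {c : ℝ}
    (hc : 0 < c) : Continuous fun y : ℝ => complexMGF S P (-((c : ℂ) + y * Complex.I)) := by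
  simp only [complexMGF]
  refine continuous_of_dominated (bound := fun _ => 1) (fun y => ?_) (fun y => ?_)
    (integrable_const _) (Eventually.of_forall fun ω => by fun_prop)
  · exact (integrable_cexp_neg hS hS0 (z := (c : ℂ) + y * Complex.I)
      (by simpa using hc.le)).aestronglyMeasurable
  · exact norm_cexp_neg_le_one hS0 (by simpa using hc.le)

/-- Integrating `w exp(tw)` over `t ∈ [0,1]` leaves only `Re w` in the exponential. Along a vertical
line the imaginary part is unbounded, so a bound by `exp ‖w‖` would be of no use for domination. -/
lemma norm_exp_sub_one_le_of_re (w : ℂ) : ‖Complex.exp w - 1‖ ≤ ‖w‖ * Real.exp (max w.re 0) := by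
  have hd : ∀ t ∈ Set.uIcc (0 : ℝ) 1, HasDerivAt (fun t : ℝ => Complex.exp (t * w))
      (Complex.exp (t * w) * w) t := fun t _ => by
    have h1 : HasDerivAt (fun x : ℝ => (x : ℂ)) 1 t := Complex.ofRealCLM.hasDerivAt
    simpa using (h1.mul_const w).cexp
  have := intervalIntegral.integral_eq_sub_of_hasDerivAt hd
    (Continuous.intervalIntegrable (by fun_prop) _ _)
  simp only [Complex.ofReal_one, one_mul, Complex.ofReal_zero, zero_mul, Complex.exp_zero] at this
  rw [← this]
  refine (intervalIntegral.norm_integral_le_of_norm_le_const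
    (C := ‖w‖ * Real.exp (max w.re 0)) fun t ht => ?_).trans (by simp)
  rw [norm_mul, mul_comm, Complex.norm_exp]
  gcongr
  rw [Set.uIoc_of_le zero_le_one] at ht
  simp only [Complex.re_ofReal_mul]
  rcases le_total 0 w.re with h | h
  · rw [max_eq_left h]; nlinarith [ht.2]
  · rw [max_eq_right h]; nlinarith [ht.1]

/-- Bromwich inversion for the distribution function of a nonnegative random variable. -/
theorem measure_le_eq (hS : AEMeasurable S P) (hS0 : ∀ᵐ ω ∂P, 0 ≤ S ω) {c : ℝ} (hc : 0 < c)
    (hint : Integrable fun y : ℝ =>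
      complexMGF S P (-((c : ℂ) + y * Complex.I)) / ((c : ℂ) + y * Complex.I)) (x : ℝ) :
    P.real {ω | S ω ≤ x} =
      (2 * Real.pi)⁻¹ * (∫ y : ℝ, Complex.exp (((c : ℂ) + y * Complex.I) * x) *
        (complexMGF S P (-((c : ℂ) + y * Complex.I)) / ((c : ℂ) + y * Complex.I))).re := by
  set L : ℝ → ℂ := fun y => complexMGF S P (-((c : ℂ) + y * Complex.I)) with hL
  set z : ℝ → ℂ := fun y => (c : ℂ) + y * Complex.I with hz
  have hz0 : ∀ y, z y ≠ 0 := line_ne_zero hc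
  have hzc : Continuous z := by fun_prop
  have hLc : Continuous L := continuous_complexMGF_line hS hS0 hc
  have hLi2 : Integrable fun y => L y / z y ^ 2 := by
    refine (integrable_inv_sq_line hc).norm.mono'
      (hLc.div (by fun_prop) fun y => pow_ne_zero _ (hz0 y)).aestronglyMeasurable
      (Eventually.of_forall fun y => ?_)
    rw [norm_div, norm_div, norm_one]
    gcongr
    refine (norm_integral_le_of_norm_le_const
      (norm_cexp_neg_le_one hS0 (z := z y) (by simpa [hz] using hc.le))).trans (by simp)
  have hExpi : ∀ x' : ℝ, Integrable fun y => Complex.exp (z y * x') * (L y / z y ^ 2) := by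
    intro x'
    refine hLi2.bdd_mul (c := Real.exp (c * x')) (by fun_prop) (Eventually.of_forall fun y => ?_)
    rw [Complex.norm_exp]
    simp [hz]
  set R : ℝ → ℝ := fun x' => ∫ ω, max (x' - S ω) 0 ∂P with hR
  have hRi : ∀ x' : ℝ, Integrable (fun ω => max (x' - S ω) 0) P := by
    intro x'
    refine (integrable_const |x'|).mono'
      ((by fun_prop : AEMeasurable _ P).aestronglyMeasurable) ?_
    filter_upwards [hS0] with ω hω
    rw [Real.norm_of_nonneg (le_max_right _ _)]
    exact max_le ((sub_le_self _ hω).trans (le_abs_self _)) (abs_nonneg _)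
  -- the difference quotient of the ramp converges to the Bromwich integral
  have hquot : Tendsto (fun h : ℝ => ((R (x + h) - R x) / h : ℝ)) (𝓝[≠] 0)
      (𝓝 ((2 * Real.pi)⁻¹ * (∫ y, Complex.exp (z y * x) * (L y / z y)).re)) := by
    have hq : ∀ h : ℝ, h ≠ 0 → ((R (x + h) - R x) / h : ℝ) = (2 * Real.pi)⁻¹ *
        (∫ y, Complex.exp (z y * x) * (L y / z y) *
          ((Complex.exp (z y * h) - 1) / (z y * h))).re := by
      intro h hh
      have e1 := integral_ramp_eq hS hS0 hc (x + h)
      have e2 := integral_ramp_eq hS hS0 hc x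
      have e3 : (∫ y, Complex.exp (z y * x) * (L y / z y) *
          ((Complex.exp (z y * h) - 1) / (z y * h)))
          = 2 * Real.pi * (((R (x + h) - R x) / h : ℝ) : ℂ) := by
        have : ∀ y, Complex.exp (z y * x) * (L y / z y) *
          ((Complex.exp (z y * h) - 1) / (z y * h)) =
          (Complex.exp (z y * (x + h : ℝ)) * (L y / z y ^ 2) -
            Complex.exp (z y * x) * (L y / z y ^ 2)) / h := by
          intro y
          have := hz0 y
          have hh' : (h : ℂ) ≠ 0 := by exact_mod_cast hh
          push_cast
          rw [mul_add, Complex.exp_add]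
          field_simp
        simp_rw [this]
        rw [integral_div, integral_sub (hExpi _) (hExpi _)]
        simp only [hL, hz]
        rw [← e1, ← e2]
        simp only [hR]
        push_cast
        ring
      rw [e3]
      have : (2 * (Real.pi : ℂ) * (((R (x + h) - R x) / h : ℝ) : ℂ)).re
          = 2 * Real.pi * ((R (x + h) - R x) / h) := by
        rw [← Complex.ofReal_re (2 * Real.pi * ((R (x + h) - R x) / h))]
        congr 1
        push_cast; ring
      rw [this, ← mul_assoc, inv_mul_cancel₀ (by positivity), one_mul]
    -- The kernel `(exp(zh) - 1)/(zh)` tends to `1` and is bounded by `exp c` for `h ≤ 1`, negative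
    -- `h` included, so the assumed integrability of `L/z` dominates.
    have hlim : Tendsto (fun h : ℝ => ∫ y, Complex.exp (z y * x) * (L y / z y) *
          ((Complex.exp (z y * h) - 1) / (z y * h))) (𝓝[≠] 0)
          (𝓝 (∫ y, Complex.exp (z y * x) * (L y / z y))) := by
      refine tendsto_integral_filter_of_dominated_convergence
        (fun y => Real.exp (c * x) * ‖L y / z y‖ * Real.exp c) ?_ ?_ ?_ ?_
      · refine Eventually.of_forall fun h => Measurable.aestronglyMeasurable ?_
        have := hLc.measurable
        fun_prop
      · have : ∀ᶠ h : ℝ in 𝓝[≠] 0, h ∈ Set.Iic (1 : ℝ) :=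
          nhdsWithin_le_nhds (Iic_mem_nhds one_pos)
        filter_upwards [this, self_mem_nhdsWithin] with h h1 h0
        refine Eventually.of_forall fun y => ?_
        rw [norm_mul, norm_mul]
        have hne : z y * h ≠ 0 := mul_ne_zero (hz0 y) (by exact_mod_cast h0)
        have b1 : ‖Complex.exp (z y * x)‖ = Real.exp (c * x) := by
          rw [Complex.norm_exp]; simp [hz]
        have b2 : ‖(Complex.exp (z y * h) - 1) / (z y * h)‖ ≤ Real.exp c := by
          rw [norm_div, div_le_iff₀ (norm_pos_iff.2 hne), mul_comm (Real.exp c)]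
          refine (norm_exp_sub_one_le_of_re _).trans ?_
          gcongr
          have : (z y * h).re = c * h := by simp [hz]
          rw [this]
          simp only [Set.mem_Iic] at h1
          exact max_le (by nlinarith) hc.le
        rw [b1]
        gcongr
      · exact (hint.norm.const_mul _).mul_const _
      · refine Eventually.of_forall fun y => ?_
        have hd : HasDerivAt (fun t : ℝ => Complex.exp (z y * t)) (z y) 0 := by
          have h1 : HasDerivAt (fun x : ℝ => (x : ℂ)) 1 (0 : ℝ) := Complex.ofRealCLM.hasDerivAt
          simpa using (h1.const_mul (z y)).cexp
        have hs := hd.tendsto_slope_zero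
        have h2 := (hs.const_mul (Complex.exp (z y * x) * (L y / z y))).mul_const ((z y)⁻¹)
        rw [mul_assoc, mul_inv_cancel₀ (hz0 y), mul_one] at h2
        refine h2.congr fun h => ?_
        simp only [zero_add, Complex.ofReal_zero, mul_zero, Complex.exp_zero]
        rw [Complex.real_smul]
        push_cast
        field_simp
    have hre := (Complex.continuous_re.tendsto _).comp hlim
    refine (hre.const_mul _).congr' ?_
    filter_upwards [self_mem_nhdsWithin] with h hh
    exact (hq h hh).symm
  have hAm : NullMeasurableSet {ω | S ω ≤ x} P := nullMeasurableSet_le hS aemeasurable_const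
  have hind : P.real {ω | S ω ≤ x} = ∫ ω, Set.indicator {ω | S ω ≤ x} (fun _ => (1 : ℝ)) ω ∂P := by
    rw [integral_indicator₀ hAm]; simp
  have hindi : Integrable (Set.indicator {ω | S ω ≤ x} (fun _ => (1 : ℝ))) P :=
    (integrable_const _).indicator₀ hAm
  -- The ramp is convex with right slope `1_{S ≤ x}`: forward quotients lie above the indicator and
  -- backward ones below. Both have the same limit, so the probability is squeezed, and no separate
  -- argument about atoms is needed.
  have hup : ∀ h : ℝ, 0 < h → P.real {ω | S ω ≤ x} ≤ (R (x + h) - R x) / h := by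
    intro h hh
    rw [hind, hR, ← integral_sub (hRi _) (hRi _), ← integral_div]
    refine integral_mono hindi (((hRi _).sub (hRi _)).div_const _) fun ω => ?_
    simp only [Set.indicator, Set.mem_ofPred_eq]
    rw [le_div_iff₀ hh]
    split_ifs with hω
    · rw [max_eq_left (by linarith), max_eq_left (by linarith)]; linarith
    · have : max (x - S ω) 0 ≤ max (x + h - S ω) 0 := max_le_max (by linarith) le_rfl
      linarith
  have hdown : ∀ h : ℝ, h < 0 → (R (x + h) - R x) / h ≤ P.real {ω | S ω ≤ x} := by
    intro h hh
    rw [hind, hR, ← integral_sub (hRi _) (hRi _), ← integral_div]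
    refine integral_mono (((hRi _).sub (hRi _)).div_const _) hindi fun ω => ?_
    simp only [Set.indicator, Set.mem_ofPred_eq]
    rw [div_le_iff_of_neg hh]
    split_ifs with hω
    · have h1 : x - S ω ≤ max (x - S ω) 0 := le_max_left _ _
      have h2 : max (x - S ω) 0 = x - S ω := max_eq_left (by linarith)
      have h3 : x + h - S ω ≤ max (x + h - S ω) 0 := le_max_left _ _
      linarith
    · rw [max_eq_right (by linarith), max_eq_right (by linarith)]; simp
  have hle : P.real {ω | S ω ≤ x} ≤
      (2 * Real.pi)⁻¹ * (∫ y, Complex.exp (z y * x) * (L y / z y)).re := by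
    refine ge_of_tendsto (hquot.mono_left (nhdsWithin_mono 0 (s := Set.Ioi 0) ?_)) ?_
    · intro a ha; exact ne_of_gt ha
    · filter_upwards [self_mem_nhdsWithin] with h hh using hup h hh
  have hge : (2 * Real.pi)⁻¹ * (∫ y, Complex.exp (z y * x) * (L y / z y)).re
      ≤ P.real {ω | S ω ≤ x} := by
    refine le_of_tendsto (hquot.mono_left (nhdsWithin_mono 0 (s := Set.Iio 0) ?_)) ?_
    · intro a ha; exact ne_of_lt ha
    · filter_upwards [self_mem_nhdsWithin] with h hh using hdown h hh
  exact le_antisymm hle hge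

end LaplaceInversion

/-! ### The principal square root on the right half-plane. -/

namespace Complex

lemma sqrt_sq' (z : ℂ) : z.sqrt ^ 2 = z := by
  rw [Complex.sqrt]; exact cpow_ofNat_inv_pow z 2

lemma re_sqrt_nonneg (z : ℂ) : 0 ≤ z.sqrt.re := by
  rw [Complex.sqrt, cpow_inv_two_re]; positivity

lemma re_sq_sub_im_sq_sqrt (z : ℂ) : z.sqrt.re ^ 2 - z.sqrt.im ^ 2 = z.re := by
  have := congrArg re (sqrt_sq' z)
  simpa [sq] using this

lemma re_sqrt_pos {z : ℂ} (hz : 0 < z.re) : 0 < z.sqrt.re := by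
  refine lt_of_le_of_ne (re_sqrt_nonneg z) fun h => ?_
  have := re_sq_sub_im_sq_sqrt z
  rw [← h] at this
  nlinarith [sq_nonneg z.sqrt.im]

lemma sqrt_ne_zero_of_re_pos {z : ℂ} (hz : 0 < z.re) : z.sqrt ≠ 0 := fun h => by
  have := re_sqrt_pos hz
  simp [h] at this

lemma sqrt_eq_of_sq_eq {z w : ℂ} (hw : 0 < w.re) (h : w ^ 2 = z) : z.sqrt = w := by
  have h2 : z.sqrt ^ 2 = w ^ 2 := by rw [sqrt_sq', h]
  rcases sq_eq_sq_iff_eq_or_eq_neg.1 h2 with h3 | h3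
  · exact h3
  · have := re_sqrt_nonneg z
    rw [h3] at this
    simp at this; linarith

lemma sqrt_ofReal {x : ℝ} (hx : 0 < x) : (x : ℂ).sqrt = (√x : ℝ) := by
  refine sqrt_eq_of_sq_eq (by simpa using Real.sqrt_pos.2 hx) ?_
  rw [← ofReal_pow, Real.sq_sqrt hx.le]

lemma sqrt_ofReal_sq_mul {r : ℝ} (hr : 0 < r) {z : ℂ} (hz : 0 < z.re) :
    ((r : ℂ) ^ 2 * z).sqrt = r * z.sqrt := by
  refine sqrt_eq_of_sq_eq ?_ ?_
  · simpa using mul_pos hr (re_sqrt_pos hz)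
  · rw [mul_pow, sqrt_sq']

lemma sqrt_ofReal_mul {r : ℝ} (hr : 0 < r) {z : ℂ} (hz : 0 < z.re) :
    ((r : ℂ) * z).sqrt = (√r : ℝ) * z.sqrt := by
  refine sqrt_eq_of_sq_eq ?_ ?_
  · rw [re_ofReal_mul]; exact mul_pos (Real.sqrt_pos.2 hr) (re_sqrt_pos hz)
  · rw [mul_pow, sqrt_sq', ← ofReal_pow, Real.sq_sqrt hr.le]

lemma continuousAt_sqrt_of_re_pos {z : ℂ} (hz : 0 < z.re) : ContinuousAt Complex.sqrt z := by
  unfold Complex.sqrt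
  exact continuousAt_cpow_const (Or.inl hz)

lemma analyticAt_sqrt {z : ℂ} (hz : 0 < z.re) : AnalyticAt ℂ Complex.sqrt z := by
  unfold Complex.sqrt
  exact analyticAt_id.cpow analyticAt_const (Or.inl hz)

/-- If the real part of `f` tends to infinity then so does the real part of its square root. -/
lemma tendsto_re_sqrt {α : Type*} {l : Filter α} {f : α → ℂ}
    (hf : Tendsto (fun a => (f a).re) l atTop) :
    Tendsto (fun a => (f a).sqrt.re) l atTop := by
  refine tendsto_atTop_mono (fun a => ?_) (Real.tendsto_sqrt_atTop.comp hf)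
  simp only [Function.comp]
  refine Real.sqrt_le_iff.2 ⟨re_sqrt_nonneg _, ?_⟩
  nlinarith [re_sq_sub_im_sq_sqrt (f a), sq_nonneg (f a).sqrt.im]

lemma tendsto_inv_of_re {α : Type*} {l : Filter α} {f : α → ℂ}
    (hf : Tendsto (fun a => (f a).re) l atTop) : Tendsto (fun a => (f a)⁻¹) l (𝓝 0) := by
  refine tendsto_inv₀_cobounded.comp ?_
  rw [← tendsto_norm_atTop_iff_cobounded]
  exact tendsto_atTop_mono (fun a => re_le_norm _) hf

end Complex

/-! ### The phase estimate and the choice of the branch of the square root of the transform. -/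

namespace SmallBall

open Complex in
/-- The phase bound: `exp (-(p/2)(Re √(1+iq) - 1))` is dominated by an integrable function of
`τ = q √p`, uniformly in `p ≥ 1`. -/
lemma phase_bound : ∃ K : ℝ, 0 < K ∧ ∀ p : ℝ, 1 ≤ p → ∀ q : ℝ,
    Real.exp (-(p / 2 * ((1 + q * Complex.I).sqrt.re - 1))) ≤ K * (1 + p * q ^ 2)⁻¹ := by
  have hex : ∃ K : ℝ, 0 < K ∧ ∀ v : ℝ, 0 ≤ v →
      (1 + 16 * v * (1 + 2 * v) ^ 3) * Real.exp (-v) ≤ K := by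
    -- The constant is generous: the polynomial is at most `2000 + 2000 v⁴`, and `1` and `v⁴/24` are
    -- both at most `exp v`.
    refine ⟨5000000, by norm_num, fun v hv => ?_⟩
    have h4 : v ^ 4 / 24 ≤ Real.exp v := by
      have := Real.pow_div_factorial_le_exp v hv 4
      simpa [Nat.factorial] using this
    have h1 : 1 ≤ Real.exp v := Real.one_le_exp hv
    rw [Real.exp_neg, ← div_eq_mul_inv, div_le_iff₀ (Real.exp_pos v)]
    have : 1 + 16 * v * (1 + 2 * v) ^ 3 ≤ 2000 + 2000 * v ^ 4 := by
      rcases le_total v 1 with h | h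
      · have h3 : (1 + 2 * v) ^ 3 ≤ 3 ^ 3 := by gcongr; linarith
        nlinarith [pow_nonneg hv 4, pow_nonneg (by linarith : 0 ≤ 1 + 2 * v) 3]
      · have h3 : (1 + 2 * v) ^ 3 ≤ (3 * v) ^ 3 := by gcongr; linarith
        have : v * (1 + 2 * v) ^ 3 ≤ v * (3 * v) ^ 3 := by gcongr
        nlinarith [pow_nonneg hv 4]
    linarith
  obtain ⟨K, hK0, hK⟩ := hex
  refine ⟨K, hK0, fun p hp q => ?_⟩
  set u := (1 + q * Complex.I).sqrt with hu
  have h1 : u.re ^ 2 - u.im ^ 2 = 1 := by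
    have := re_sq_sub_im_sq_sqrt (1 + q * Complex.I)
    simpa using this
  have h2 : 2 * u.re * u.im = q := by
    have := congrArg Complex.im (sqrt_sq' (1 + q * Complex.I))
    rw [← hu] at this
    simp [sq] at this
    linarith
  have h0 : 0 ≤ u.re := re_sqrt_nonneg _
  have hge : 1 ≤ u.re := by nlinarith [sq_nonneg u.im]
  set m := u.re - 1 with hm
  have hm0 : 0 ≤ m := by linarith
  have hre : u.re = 1 + m := by linarith
  have hq : q ^ 2 = 4 * (1 + m) ^ 2 * (m * (2 + m)) := by
    rw [← h2, mul_pow, mul_pow]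
    have : u.im ^ 2 = m * (2 + m) := by rw [hre] at h1; linarith
    rw [this, hre]; ring
  set v := p / 2 * m with hv
  have hv0 : 0 ≤ v := by positivity
  have hmv : m ≤ 2 * v := by rw [hv]; nlinarith
  -- The imaginary part is eliminated through `Re u = 1 + m`. Since `m ≤ 2v` when `p ≥ 1`, `p q²` is
  -- bounded by a polynomial in the decay exponent `v` alone, which `exp(-v)` absorbs uniformly in
  -- `p`.
  have hpq : p * q ^ 2 ≤ 16 * v * (1 + 2 * v) ^ 3 := by
    have e : p * q ^ 2 = 8 * v * ((1 + m) ^ 2 * (2 + m)) := by rw [hq, hv]; ring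
    have e2 : (1 + m) ^ 2 * (2 + m) ≤ (1 + 2 * v) ^ 2 * (2 * (1 + 2 * v)) := by
      gcongr; linarith
    rw [e]
    calc 8 * v * ((1 + m) ^ 2 * (2 + m)) ≤ 8 * v * ((1 + 2 * v) ^ 2 * (2 * (1 + 2 * v))) := by
          gcongr
      _ = _ := by ring
  have hpos : 0 < 1 + p * q ^ 2 := by positivity
  rw [← div_eq_mul_inv, le_div_iff₀ hpos]
  calc Real.exp (-v) * (1 + p * q ^ 2)
      ≤ Real.exp (-v) * (1 + 16 * v * (1 + 2 * v) ^ 3) := by gcongr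
    _ ≤ K := by rw [mul_comm]; exact hK v hv0

/-- The normalized transform: `L z ≈ C √p exp(-p/2)` with `p = √(2z)`. -/
noncomputable def normalized (L : ℂ → ℂ) (z : ℂ) : ℂ :=
  L z * Complex.exp ((2 * z).sqrt / 2) / (2 * z).sqrt.sqrt

lemma normalized_sq (L : ℂ → ℂ) (z : ℂ) :
    normalized L z ^ 2 = L z ^ 2 * Complex.exp ((2 * z).sqrt) / (2 * z).sqrt := by
  rw [normalized, div_pow, mul_pow, Complex.sqrt_sq', ← Complex.exp_nat_mul]
  congr 3
  push_cast; ring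

lemma tendsto_two_mul_re_comap :
    Tendsto (fun z : ℂ => (2 * z).re) (comap Complex.re atTop) atTop := by
  have : Tendsto (fun z : ℂ => 2 * z.re) (comap Complex.re atTop) atTop :=
    tendsto_comap.const_mul_atTop two_pos
  simpa using this

/-- The sign of the square root is determined by positivity on the real axis. -/
lemma tendsto_normalized {L : ℂ → ℂ} {C : ℝ} (hC : 0 < C)
    (hLc : ∀ c : ℝ, 0 < c → Continuous fun y : ℝ => L ((c : ℂ) + y * Complex.I))
    (hLpos : ∀ c : ℝ, 0 < c → ∃ r : ℝ, 0 < r ∧ L c = r)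
    (hlim : Tendsto (fun z => L z ^ 2 * Complex.exp ((2 * z).sqrt) / (2 * z).sqrt)
      (comap Complex.re atTop) (𝓝 ((C : ℂ) ^ 2))) :
    Tendsto (normalized L) (comap Complex.re atTop) (𝓝 C) := by
  have hlim' : Tendsto (fun z => normalized L z ^ 2) (comap Complex.re atTop) (𝓝 ((C : ℂ) ^ 2)) :=
    hlim.congr fun z => (normalized_sq L z).symm
  rw [Metric.tendsto_nhds] at hlim' ⊢
  intro ε hε
  have hδ : 0 < min (ε * C) (C ^ 2) := by positivity
  have h1 := hlim' _ hδ
  rw [eventually_comap, eventually_atTop] at h1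
  obtain ⟨R, hR⟩ := h1
  rw [eventually_comap, eventually_atTop]
  refine ⟨max R 1, fun c hc z hz => ?_⟩
  have hc0 : 0 < c := lt_of_lt_of_le one_pos ((le_max_right _ _).trans hc)
  have hcR : R ≤ c := (le_max_left _ _).trans hc
  have hcont : Continuous fun y : ℝ => (normalized L ((c : ℂ) + y * Complex.I)).re := by
    refine Complex.continuous_re.comp ?_
    have hpos : ∀ y : ℝ, 0 < (2 * ((c : ℂ) + y * Complex.I)).re := fun y => by simpa using hc0
    have hs : Continuous fun y : ℝ => (2 * ((c : ℂ) + y * Complex.I)).sqrt :=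
      continuous_iff_continuousAt.2 fun y =>
        (Complex.continuousAt_sqrt_of_re_pos (hpos y)).comp
          (f := fun y : ℝ => 2 * ((c : ℂ) + y * Complex.I)) (by fun_prop)
    have hss : Continuous fun y : ℝ => (2 * ((c : ℂ) + y * Complex.I)).sqrt.sqrt :=
      continuous_iff_continuousAt.2 fun y =>
        (Complex.continuousAt_sqrt_of_re_pos (Complex.re_sqrt_pos (hpos y))).comp
          (f := fun y : ℝ => (2 * ((c : ℂ) + y * Complex.I)).sqrt) hs.continuousAt
    refine Continuous.div ((hLc c hc0).mul ?_) hss fun y =>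
      Complex.sqrt_ne_zero_of_re_pos (Complex.re_sqrt_pos (hpos y))
    exact Complex.continuous_exp.comp (hs.div_const 2)
  -- A purely imaginary `w` has `Re(w²) ≤ 0`, hence lies at distance at least `C²` from satisfying
  -- `w² = C²`. The normalized transform therefore never crosses the imaginary axis on the line `Re
  -- z = c`.
  have hne : ∀ y : ℝ, (normalized L ((c : ℂ) + y * Complex.I)).re ≠ 0 := by
    intro y h0
    have := hR c hcR ((c : ℂ) + y * Complex.I) (by simp)
    have h2 := this.trans_le (min_le_right _ _)
    rw [dist_eq_norm] at h2
    set w := normalized L ((c : ℂ) + y * Complex.I)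
    have h3 : |(w ^ 2 - (C : ℂ) ^ 2).re| < C ^ 2 := (Complex.abs_re_le_norm _).trans_lt h2
    have h4 : (w ^ 2 - (C : ℂ) ^ 2).re = -(w.im ^ 2) - C ^ 2 := by
      simp [sq, h0]
    rw [h4, abs_lt] at h3
    nlinarith [sq_nonneg w.im]
  have hp0 : 0 < (normalized L ((c : ℂ) + (0 : ℝ) * Complex.I)).re := by
    obtain ⟨r, hr, hLr⟩ := hLpos c hc0
    have h2c : (0 : ℝ) < 2 * c := by linarith
    have e1 : (2 * ((c : ℂ) + (0 : ℝ) * Complex.I)) = ((2 * c : ℝ) : ℂ) := by simp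
    rw [normalized, e1, Complex.sqrt_ofReal h2c, Complex.sqrt_ofReal (Real.sqrt_pos.2 h2c)]
    simp only [Complex.ofReal_zero, zero_mul, add_zero, hLr]
    have e2 : (r : ℂ) * Complex.exp ((√(2 * c) : ℝ) / 2) / (√√(2 * c) : ℝ)
        = ((r * Real.exp (√(2 * c) / 2) / √√(2 * c) : ℝ) : ℂ) := by push_cast; rfl
    rw [e2, Complex.ofReal_re]
    positivity
  -- By the intermediate value theorem the real part keeps the positive sign it has at `y = 0`. This
  -- keeps `w + C` away from `0` and selects the root `C` of `w² = C²` rather than `-C`.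
  have hpos : ∀ y : ℝ, 0 < (normalized L ((c : ℂ) + y * Complex.I)).re := by
    intro y
    by_contra hy
    obtain ⟨y', hy'⟩ := mem_range_of_exists_le_of_exists_ge hcont ⟨y, not_lt.1 hy⟩ ⟨0, hp0.le⟩
    exact hne y' hy'
  have hzeq : z = (c : ℂ) + z.im * Complex.I := by rw [← hz]; simp
  have hre := hpos z.im
  rw [← hzeq] at hre
  have hd := (hR c hcR z hz).trans_le (min_le_left _ _)
  rw [dist_eq_norm] at hd ⊢
  have hfac : normalized L z ^ 2 - (C : ℂ) ^ 2 = (normalized L z - C) * (normalized L z + C) := by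
    ring
  rw [hfac, norm_mul] at hd
  have hge : C ≤ ‖normalized L z + C‖ := by
    refine le_trans ?_ (Complex.re_le_norm _)
    simp; linarith
  have : ‖normalized L z - C‖ * C < ε * C :=
    lt_of_le_of_lt (by gcongr) hd
  exact lt_of_mul_lt_mul_right this hC.le

end SmallBall

/-! ### The saddle point method. -/

namespace SmallBall

/-- Square root of the rescaled vertical line through `1`. -/
noncomputable def saddleRoot (p τ : ℝ) : ℂ := (1 + (τ / √p : ℝ) * Complex.I).sqrt

/-- Point of the line `Re z = p²/2`, rescaled to the width of the saddle. -/
noncomputable def saddlePoint (p τ : ℝ) : ℂ :=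
  ((p ^ 2 / 2 : ℝ) : ℂ) + (p ^ 2 / 2 / √p * τ : ℝ) * Complex.I

/-- This is the Bromwich integrand at `x = 1/(2p)`, multiplied by the Jacobian of the rescaling and
by `exp(p/4)`, once the leading behaviour of `L` has been split off. -/
noncomputable def saddleIntegrand (L : ℂ → ℂ) (p τ : ℝ) : ℂ :=
  normalized L (saddlePoint p τ) * ((saddleRoot p τ).sqrt / saddleRoot p τ ^ 2) *
    Complex.exp (p / 4 * (saddleRoot p τ - 1) ^ 2)

lemma saddleRoot_sq (p τ : ℝ) : saddleRoot p τ ^ 2 = 1 + (τ / √p : ℝ) * Complex.I :=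
  Complex.sqrt_sq' _

lemma one_le_re_saddleRoot (p τ : ℝ) : 1 ≤ (saddleRoot p τ).re := by
  have h := Complex.re_sq_sub_im_sq_sqrt (1 + (τ / √p : ℝ) * Complex.I)
  have h0 := Complex.re_sqrt_nonneg (1 + (τ / √p : ℝ) * Complex.I)
  rw [← saddleRoot] at h h0
  have : (1 + (τ / √p : ℝ) * Complex.I).re = 1 := by simp
  rw [this] at h
  nlinarith [sq_nonneg (saddleRoot p τ).im]

lemma one_le_norm_saddleRoot (p τ : ℝ) : 1 ≤ ‖saddleRoot p τ‖ :=
  (one_le_re_saddleRoot p τ).trans (Complex.re_le_norm _)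

lemma saddleRoot_ne_zero (p τ : ℝ) : saddleRoot p τ ≠ 0 :=
  norm_pos_iff.1 (one_pos.trans_le (one_le_norm_saddleRoot p τ))

lemma saddlePoint_eq {p : ℝ} (τ : ℝ) :
    2 * saddlePoint p τ = (p : ℂ) ^ 2 * (1 + (τ / √p : ℝ) * Complex.I) := by
  rw [saddlePoint]; push_cast; ring

lemma saddlePoint_ne_zero {p : ℝ} (hp : 0 < p) (τ : ℝ) : saddlePoint p τ ≠ 0 := fun h => by
  have := congrArg Complex.re h
  have h2 : (saddlePoint p τ).re = p ^ 2 / 2 := by simp [saddlePoint, -Complex.ofReal_div]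
  rw [h2] at this
  simp at this
  exact hp.ne' this

lemma sqrt_two_mul_saddlePoint {p : ℝ} (hp : 0 < p) (τ : ℝ) :
    (2 * saddlePoint p τ).sqrt = p * saddleRoot p τ := by
  rw [saddlePoint_eq, Complex.sqrt_ofReal_sq_mul hp (by simp [-Complex.ofReal_div]), saddleRoot]

/-- With `z = p² u²/2` the two exponents are `z x = p u²/4` and `-√(2z)/2 = -p u/2`. Adding `p/4`
completes the square to `p (u - 1)²/4`. -/
lemma saddleIntegrand_eq (L : ℂ → ℂ) {p : ℝ} (hp : 0 < p) (τ : ℝ) :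
    Complex.exp (saddlePoint p τ * (1 / (2 * p) : ℝ)) * (L (saddlePoint p τ) / saddlePoint p τ) *
      (p ^ 2 / 2 / √p : ℝ) * Real.exp (p / 4) = saddleIntegrand L p τ := by
  have hre : 0 < (saddleRoot p τ).re := one_pos.trans_le (one_le_re_saddleRoot p τ)
  have hu0 := saddleRoot_ne_zero p τ
  have hus := Complex.sqrt_ne_zero_of_re_pos hre
  have hsp : √p ≠ 0 := (Real.sqrt_pos.2 hp).ne'
  have hspc : ((√p : ℝ) : ℂ) ≠ 0 := by exact_mod_cast hsp
  have hpc : (p : ℂ) ≠ 0 := by exact_mod_cast hp.ne'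
  have hz : saddlePoint p τ = p ^ 2 / 2 * saddleRoot p τ ^ 2 := by
    have := saddlePoint_eq (p := p) τ
    rw [← saddleRoot_sq] at this
    linear_combination this / 2
  rw [saddleIntegrand, normalized, sqrt_two_mul_saddlePoint hp,
    Complex.sqrt_ofReal_mul hp hre]
  have hexp : Complex.exp (p / 4 * (saddleRoot p τ - 1) ^ 2) * Complex.exp (p * saddleRoot p τ / 2)
      = Complex.exp (saddlePoint p τ * (1 / (2 * p) : ℝ)) * Real.exp (p / 4) := by
    rw [Complex.ofReal_exp, ← Complex.exp_add, ← Complex.exp_add]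
    congr 1
    rw [hz]
    push_cast
    field_simp
    ring
  have hz' : L (saddlePoint p τ) / saddlePoint p τ
      = L (saddlePoint p τ) / (p ^ 2 / 2 * saddleRoot p τ ^ 2) := by rw [← hz]
  rw [hz']
  generalize saddleRoot p τ = u at *
  generalize L (saddlePoint p τ) = l
  generalize hE : Complex.exp (saddlePoint p τ * (1 / (2 * p) : ℝ)) = E at *
  calc _ = l / (p ^ 2 / 2 * u ^ 2) * (p ^ 2 / 2 / √p : ℝ) * (E * Real.exp (p / 4)) := by ring
    _ = _ := by
      rw [← hexp]
      push_cast
      field_simp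

/-- Since `Re(u²) = 1`, one has `Re((u - 1)²) = 2 - 2 Re u`, which is the exponent of `phase_bound`
with `q = τ/√p`. -/
lemma norm_exp_saddle_le : ∃ K : ℝ, 0 < K ∧ ∀ p : ℝ, 1 ≤ p → ∀ τ : ℝ,
    ‖Complex.exp (p / 4 * (saddleRoot p τ - 1) ^ 2)‖ ≤ K * (1 + τ ^ 2)⁻¹ := by
  obtain ⟨K, hK0, hK⟩ := phase_bound
  refine ⟨K, hK0, fun p hp τ => ?_⟩
  have hp0 : 0 < p := by linarith
  have h := hK p hp (τ / √p)
  have h2 : p * (τ / √p) ^ 2 = τ ^ 2 := by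
    rw [div_pow, Real.sq_sqrt hp0.le]; field_simp
  rw [h2] at h
  refine le_trans (le_of_eq ?_) h
  rw [Complex.norm_exp]
  congr 1
  change _ = -(p / 2 * ((saddleRoot p τ).re - 1))
  have e : (p / 4 * (saddleRoot p τ - 1) ^ 2 : ℂ) =
      ((p / 4 : ℝ) : ℂ) * (1 + (τ / √p : ℝ) * Complex.I + 1 - 2 * saddleRoot p τ) := by
    rw [← saddleRoot_sq]; push_cast; ring
  rw [e, Complex.re_ofReal_mul]
  simp [-Complex.ofReal_div]
  ring

lemma tendsto_saddleRoot (τ : ℝ) : Tendsto (fun p => saddleRoot p τ) atTop (𝓝 1) := by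
  have h1 : Tendsto (fun p : ℝ => (τ / √p : ℝ)) atTop (𝓝 0) :=
    tendsto_const_nhds.div_atTop Real.tendsto_sqrt_atTop
  have h2 : Tendsto (fun p : ℝ => 1 + ((τ / √p : ℝ) : ℂ) * Complex.I) atTop
      (𝓝 (1 + ((0 : ℝ) : ℂ) * Complex.I)) :=
    tendsto_const_nhds.add (((Complex.continuous_ofReal.tendsto _).comp h1).mul_const _)
  simp only [Complex.ofReal_zero, zero_mul, add_zero] at h2
  have h3 := (Complex.continuousAt_sqrt_of_re_pos (z := 1) (by simp)).tendsto.comp h2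
  have h4 : (1 : ℂ).sqrt = 1 := Complex.sqrt_eq_of_sq_eq (by simp) (by simp)
  rw [h4] at h3
  exact h3

lemma tendsto_saddlePoint (τ : ℝ) :
    Tendsto (fun p => saddlePoint p τ) atTop (comap Complex.re atTop) := by
  rw [tendsto_comap_iff]
  have : (Complex.re ∘ fun p => saddlePoint p τ) = fun p : ℝ => p ^ 2 / 2 := by
    ext p; simp [saddlePoint, -Complex.ofReal_div]
  rw [this]
  exact (tendsto_pow_atTop two_ne_zero).atTop_div_const two_pos

/-- From `(u - 1)(u + 1) = iτ/√p` the exponent equals `-τ²/(4 (u + 1)²)`, and `u → 1` turns this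
into `-τ²/16`. -/
lemma tendsto_saddleIntegrand {L : ℂ → ℂ} {C : ℝ}
    (hL : Tendsto (normalized L) (comap Complex.re atTop) (𝓝 C)) (τ : ℝ) :
    Tendsto (fun p => saddleIntegrand L p τ) atTop
      (𝓝 ((C * Real.exp (-(1 / 16) * τ ^ 2) : ℝ) : ℂ)) := by
  have hu := tendsto_saddleRoot τ
  have h1 := hL.comp (tendsto_saddlePoint τ)
  have hs := (Complex.continuousAt_sqrt_of_re_pos (z := 1) (by simp)).tendsto.comp hu
  have h4 : (1 : ℂ).sqrt = 1 := Complex.sqrt_eq_of_sq_eq (by simp) (by simp)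
  rw [h4] at hs
  have h2 := hs.div (hu.pow 2) (by simp)
  have h3 : Tendsto (fun p : ℝ => Complex.exp (p / 4 * (saddleRoot p τ - 1) ^ 2)) atTop
      (𝓝 (Complex.exp (-((τ : ℂ) ^ 2 / 4) / (1 + 1) ^ 2))) := by
    have h5 : Tendsto (fun p : ℝ => -((τ : ℂ) ^ 2 / 4) / (saddleRoot p τ + 1) ^ 2) atTop
        (𝓝 (-((τ : ℂ) ^ 2 / 4) / (1 + 1) ^ 2)) :=
      tendsto_const_nhds.div ((hu.add_const 1).pow 2) (by norm_num)
    refine ((Complex.continuous_exp.tendsto _).comp h5).congr' ?_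
    filter_upwards [eventually_gt_atTop 0] with p hp
    simp only [Function.comp]
    congr 1
    have hne : saddleRoot p τ + 1 ≠ 0 := fun h => by
      have := congrArg Complex.re h
      have h1 := one_le_re_saddleRoot p τ
      simp at this; linarith
    rw [div_eq_iff (pow_ne_zero _ hne), mul_assoc, ← mul_pow]
    have e : (saddleRoot p τ - 1) * (saddleRoot p τ + 1) = (τ / √p : ℝ) * Complex.I := by
      linear_combination saddleRoot_sq p τ
    rw [e, mul_pow, Complex.I_sq, ← Complex.ofReal_pow (τ / √p), div_pow, Real.sq_sqrt hp.le]
    have hpc : (p : ℂ) ≠ 0 := by exact_mod_cast hp.ne'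
    push_cast
    field_simp
  have := (h1.mul h2).mul h3
  have hval : (C : ℂ) * (1 / 1 ^ 2) * Complex.exp (-((τ : ℂ) ^ 2 / 4) / (1 + 1) ^ 2) =
      ((C * Real.exp (-(1 / 16) * τ ^ 2) : ℝ) : ℂ) := by
    push_cast
    rw [one_pow, div_one, mul_one]
    congr 2
    ring
  rw [hval] at this
  exact this

/-- Saddle point evaluation of the Bromwich integral along `Re z = p²/2`, at `x = 1/(2p)`. -/
theorem bromwich_asymptotics {L : ℂ → ℂ} {C : ℝ}
    (hLc : ∀ c : ℝ, 0 < c → Continuous fun y : ℝ => L ((c : ℂ) + y * Complex.I))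
    (hL : Tendsto (normalized L) (comap Complex.re atTop) (𝓝 C)) :
    (∀ᶠ p : ℝ in atTop, Integrable fun y : ℝ =>
      L (((p ^ 2 / 2 : ℝ) : ℂ) + y * Complex.I) / (((p ^ 2 / 2 : ℝ) : ℂ) + y * Complex.I)) ∧
    Tendsto (fun p : ℝ => (2 * Real.pi)⁻¹ * (∫ y : ℝ,
      Complex.exp ((((p ^ 2 / 2 : ℝ) : ℂ) + y * Complex.I) * (1 / (2 * p) : ℝ)) *
      (L (((p ^ 2 / 2 : ℝ) : ℂ) + y * Complex.I) /
        (((p ^ 2 / 2 : ℝ) : ℂ) + y * Complex.I))).re * Real.exp (p / 4)) atTop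
      (𝓝 (2 * C / √Real.pi)) := by
  obtain ⟨K, hK0, hK⟩ := norm_exp_saddle_le
  have hbd : ∀ᶠ p : ℝ in atTop, ∀ τ : ℝ, ‖normalized L (saddlePoint p τ)‖ ≤ |C| + 1 := by
    have h1 : ∀ᶠ z in comap Complex.re atTop, ‖normalized L z‖ < |C| + 1 := by
      refine hL.norm.eventually (gt_mem_nhds ?_)
      rw [Complex.norm_real, Real.norm_eq_abs]; linarith
    rw [eventually_comap, eventually_atTop] at h1
    obtain ⟨R, hR⟩ := h1
    have h2 : Tendsto (fun p : ℝ => p ^ 2 / 2) atTop atTop :=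
      (tendsto_pow_atTop two_ne_zero).atTop_div_const two_pos
    filter_upwards [h2.eventually_ge_atTop R] with p hp τ
    exact (hR _ hp _ (by simp [saddlePoint, -Complex.ofReal_div])).le
  have hgb : ∀ᶠ p : ℝ in atTop, ∀ τ : ℝ,
      ‖saddleIntegrand L p τ‖ ≤ (|C| + 1) * 1 * (K * (1 + τ ^ 2)⁻¹) := by
    filter_upwards [hbd, eventually_ge_atTop 1] with p hp h1 τ
    rw [saddleIntegrand, norm_mul, norm_mul]
    have hs : ‖(saddleRoot p τ).sqrt / saddleRoot p τ ^ 2‖ ≤ 1 := by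
      have hu1 := one_le_norm_saddleRoot p τ
      have hsq : ‖(saddleRoot p τ).sqrt‖ ^ 2 = ‖saddleRoot p τ‖ := by
        rw [← norm_pow, Complex.sqrt_sq']
      rw [norm_div, norm_pow, div_le_one (by positivity)]
      have hs1 : 1 ≤ ‖(saddleRoot p τ).sqrt‖ := by
        by_contra! h
        nlinarith [norm_nonneg (saddleRoot p τ).sqrt]
      nlinarith
    gcongr
    · exact hp τ
    · exact hK p h1 τ
  have hgm : ∀ᶠ p : ℝ in atTop, Continuous (saddleIntegrand L p) := by
    filter_upwards [eventually_gt_atTop 0] with p hp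
    have hfun : saddleIntegrand L p = fun τ => Complex.exp (saddlePoint p τ * (1 / (2 * p) : ℝ)) *
      (L (saddlePoint p τ) / saddlePoint p τ) * (p ^ 2 / 2 / √p : ℝ) * Real.exp (p / 4) := by
      ext τ; rw [saddleIntegrand_eq L hp]
    rw [hfun]
    have hc1 : Continuous (saddlePoint p) := by unfold saddlePoint; fun_prop
    have hc2 : Continuous fun τ => L (saddlePoint p τ) := by
      have := (hLc (p ^ 2 / 2) (by positivity)).comp
        (g := fun y : ℝ => L (((p ^ 2 / 2 : ℝ) : ℂ) + y * Complex.I))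
        (f := fun τ : ℝ => p ^ 2 / 2 / √p * τ) (by fun_prop)
      exact this
    have hc3 := hc2.div hc1 (saddlePoint_ne_zero hp)
    have hc4 : Continuous fun τ => Complex.exp (saddlePoint p τ * (1 / (2 * p) : ℝ)) := by fun_prop
    exact ((hc4.mul hc3).mul_const _).mul_const _
  have hdom : Integrable fun τ : ℝ => (|C| + 1) * 1 * (K * (1 + τ ^ 2)⁻¹) :=
    (integrable_inv_one_add_sq.const_mul _).const_mul _
  have hlim : Tendsto (fun p => ∫ τ, saddleIntegrand L p τ) atTop
      (𝓝 (∫ τ : ℝ, ((C * Real.exp (-(1 / 16) * τ ^ 2) : ℝ) : ℂ))) :=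
    tendsto_integral_filter_of_dominated_convergence _
      (hgm.mono fun p hp => hp.aestronglyMeasurable)
      (hgb.mono fun p hp => Eventually.of_forall hp) hdom
      (Eventually.of_forall fun τ => tendsto_saddleIntegrand hL τ)
  rw [integral_complex_ofReal, integral_const_mul, integral_gaussian] at hlim
  have hscale : ∀ p : ℝ, 0 < p → ∀ G : ℝ → ℂ,
      ∫ τ : ℝ, G (p ^ 2 / 2 / √p * τ) * (p ^ 2 / 2 / √p : ℝ) = ∫ y : ℝ, G y := by
    intro p hp G
    have ha : 0 < p ^ 2 / 2 / √p := by positivity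
    rw [integral_mul_const, Measure.integral_comp_mul_left, abs_of_pos (inv_pos.2 ha),
      Complex.real_smul, mul_right_comm, ← Complex.ofReal_mul, inv_mul_cancel₀ ha.ne',
      Complex.ofReal_one, one_mul]
  constructor
  · filter_upwards [hgb, hgm, eventually_gt_atTop 0] with p hp1 hp2 hp
    have ha : 0 < p ^ 2 / 2 / √p := by positivity
    have hi : Integrable (saddleIntegrand L p) :=
      hdom.mono' hp2.aestronglyMeasurable (Eventually.of_forall hp1)
    rw [← integrable_comp_mul_left_iff _ ha.ne']
    have hc1 : Continuous (saddlePoint p) := by unfold saddlePoint; fun_prop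
    -- Integrability is transferred back from the rescaled integrand: the exponential being divided
    -- out has constant modulus on the vertical line.
    have hi2 := hi.bdd_mul (c := Real.exp (-(p ^ 2 / 2 * (1 / (2 * p)))) * ‖((p ^ 2 / 2 / √p * Real.exp (p / 4) : ℝ) : ℂ)⁻¹‖)
      (f := fun τ => Complex.exp (-(saddlePoint p τ * (1 / (2 * p) : ℝ))) * ((p ^ 2 / 2 / √p * Real.exp (p / 4) : ℝ) : ℂ)⁻¹)
      (by fun_prop)
      (Eventually.of_forall fun τ => by
        rw [norm_mul, Complex.norm_exp]
        apply le_of_eq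
        congr 3
        rw [Complex.neg_re, Complex.re_mul_ofReal]
        congr 2
        simp [saddlePoint, -Complex.ofReal_div])
    refine hi2.congr (Eventually.of_forall fun τ => ?_)
    simp only
    rw [← saddleIntegrand_eq L hp]
    have hne : ((p ^ 2 / 2 / √p * Real.exp (p / 4) : ℝ) : ℂ) ≠ 0 := by
      exact_mod_cast (by positivity : p ^ 2 / 2 / √p * Real.exp (p / 4) ≠ 0)
    rw [Complex.exp_neg]
    have he := Complex.exp_ne_zero (saddlePoint p τ * (1 / (2 * p) : ℝ))
    change _ = L (saddlePoint p τ) / saddlePoint p τ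
    calc _ = (Complex.exp (saddlePoint p τ * (1 / (2 * p) : ℝ)))⁻¹ *
          Complex.exp (saddlePoint p τ * (1 / (2 * p) : ℝ)) *
          (((p ^ 2 / 2 / √p * Real.exp (p / 4) : ℝ) : ℂ)⁻¹ *
          ((p ^ 2 / 2 / √p * Real.exp (p / 4) : ℝ) : ℂ)) *
          (L (saddlePoint p τ) / saddlePoint p τ) := by push_cast; ring
      _ = _ := by rw [inv_mul_cancel₀ he, inv_mul_cancel₀ hne, one_mul, one_mul]
  · have hre := ((Complex.continuous_re.tendsto _).comp hlim).const_mul (2 * Real.pi)⁻¹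
    have hval : (2 * Real.pi)⁻¹ * ((C * √(Real.pi / (1 / 16)) : ℝ) : ℂ).re = 2 * C / √Real.pi := by
      rw [Complex.ofReal_re]
      have h16 : √(Real.pi / (1 / 16)) = 4 * √Real.pi := by
        rw [show Real.pi / (1 / 16) = 4 ^ 2 * Real.pi by ring, Real.sqrt_mul (by positivity),
          Real.sqrt_sq (by norm_num)]
      have hpi : √Real.pi ≠ 0 := (Real.sqrt_pos.2 Real.pi_pos).ne'
      have hpi2 : Real.pi = √Real.pi ^ 2 := (Real.sq_sqrt Real.pi_pos.le).symm
      rw [h16, mul_inv, inv_eq_one_div Real.pi]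
      nth_rewrite 1 [hpi2]
      field_simp
      ring
    rw [hval] at hre
    refine hre.congr' ?_
    filter_upwards [eventually_gt_atTop 0] with p hp
    simp only [Function.comp]
    rw [mul_assoc]
    congr 1
    have e := hscale p hp (fun y => Complex.exp ((((p ^ 2 / 2 : ℝ) : ℂ) + y * Complex.I) *
      (1 / (2 * p) : ℝ)) * (L (((p ^ 2 / 2 : ℝ) : ℂ) + y * Complex.I) /
        (((p ^ 2 / 2 : ℝ) : ℂ) + y * Complex.I)))
    rw [← e, ← Complex.re_mul_ofReal, ← integral_mul_const]
    congr 2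
    ext τ
    rw [← saddleIntegrand_eq L hp]
    rfl

end SmallBall

/-! ### Asymptotics and analytic continuation of the Fredholm determinant. -/

namespace SmallBall

/-- The Fredholm determinant `det (1 + 2 z K̄)` of the demeaned Ornstein-Uhlenbeck covariance, in
the variable `γ = √(2 z + β²)`. -/
noncomputable def fredholmDet (β : ℝ) (γ : ℂ) : ℂ :=
  Complex.exp (-β) / γ ^ 4 * (γ * Complex.cosh (γ / 2) + β * Complex.sinh (γ / 2)) *
    (((β + 2) * γ ^ 2 - 2 * β ^ 2) * Complex.sinh (γ / 2) + β ^ 2 * γ * Complex.cosh (γ / 2))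

/-- `fredholmDet` for real arguments. -/
noncomputable def fredholmDetReal (β γ : ℝ) : ℝ :=
  Real.exp (-β) / γ ^ 4 * (γ * Real.cosh (γ / 2) + β * Real.sinh (γ / 2)) *
    (((β + 2) * γ ^ 2 - 2 * β ^ 2) * Real.sinh (γ / 2) + β ^ 2 * γ * Real.cosh (γ / 2))

lemma ofReal_fredholmDetReal (β γ : ℝ) : (fredholmDetReal β γ : ℂ) = fredholmDet β γ := by
  simp [fredholmDetReal, fredholmDet]

/-- The correction factor in `fredholmDet β γ = e^{γ-β} / (4γ) * (…)`, as a function of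
`e^{-γ}` and `1/γ`. -/
noncomputable def detFactor (β : ℝ) (e i : ℂ) : ℂ :=
  ((1 + e) + β * i * (1 - e)) * ((β + 2 - 2 * β ^ 2 * i ^ 2) * (1 - e) + β ^ 2 * i * (1 + e))

/-- A factor `exp(γ/2)/2` is pulled out of each of the two hyperbolic brackets. What remains is a
polynomial in `exp(-γ)` and `1/γ`, both of which vanish in the limit. -/
lemma fredholmDet_eq (β : ℝ) {γ : ℂ} (hγ : γ ≠ 0) :
    fredholmDet β γ = Complex.exp (γ - β) / (4 * γ) * detFactor β (Complex.exp (-γ)) γ⁻¹ := by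
  have h1 : Complex.exp (γ / 2) ≠ 0 := Complex.exp_ne_zero _
  have e1 : Complex.exp (γ - β) = Complex.exp (γ / 2) ^ 2 * Complex.exp (-β) := by
    rw [← Complex.exp_nat_mul, ← Complex.exp_add]; congr 1; push_cast; ring
  have e2 : Complex.exp (-γ) = (Complex.exp (γ / 2) ^ 2)⁻¹ := by
    rw [← Complex.exp_nat_mul, ← Complex.exp_neg]; congr 1; push_cast; ring
  have e3 : Complex.exp (-(γ / 2)) = (Complex.exp (γ / 2))⁻¹ := Complex.exp_neg _
  rw [fredholmDet, detFactor, Complex.cosh, Complex.sinh, e1, e2, e3]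
  generalize Complex.exp (γ / 2) = E at *
  generalize Complex.exp (-β) = B
  field_simp
  ring

/-- With `p = √(2z)` and `g = √(2z + β²)`, the relation `p² - g² = -β²` forces `p - g → 0`. Hence
`exp(p - g + β) → e^β` and `g/p → 1`, while the correction factor tends to `β + 2`. -/
lemma tendsto_fredholmDet_inv {β : ℝ} (hβ : 0 < β) :
    Tendsto (fun z : ℂ => (fredholmDet β (2 * z + β ^ 2).sqrt)⁻¹ * Complex.exp ((2 * z).sqrt) /
      (2 * z).sqrt) (comap Complex.re atTop) (𝓝 ((4 * Real.exp β / (2 + β) : ℝ) : ℂ)) := by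
  set l : Filter ℂ := comap Complex.re atTop with hl
  set g : ℂ → ℂ := fun z => (2 * z + β ^ 2).sqrt with hg
  set p : ℂ → ℂ := fun z => (2 * z).sqrt with hp
  have hp1 : Tendsto (fun z => (p z).re) l atTop :=
    Complex.tendsto_re_sqrt tendsto_two_mul_re_comap
  have hg1 : Tendsto (fun z => (g z).re) l atTop := by
    refine Complex.tendsto_re_sqrt ?_
    have : (fun z : ℂ => (2 * z + (β : ℂ) ^ 2).re) = fun z : ℂ => (2 * z).re + β ^ 2 := by
      ext z; simp [← Complex.ofReal_pow]
    rw [this]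
    exact tendsto_atTop_add_const_right _ _ tendsto_two_mul_re_comap
  have hpi := Complex.tendsto_inv_of_re hp1
  have hgi := Complex.tendsto_inv_of_re hg1
  have hsum : Tendsto (fun z => (g z + p z)⁻¹) l (𝓝 0) := by
    refine Complex.tendsto_inv_of_re ?_
    simp only [Complex.add_re]
    exact hg1.atTop_add_atTop hp1
  have he : Tendsto (fun z => Complex.exp (-(g z))) l (𝓝 0) := by
    rw [tendsto_zero_iff_norm_tendsto_zero]
    simp_rw [Complex.norm_exp, Complex.neg_re]
    exact Real.tendsto_exp_neg_atTop_nhds_zero.comp hg1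
  have hev : ∀ᶠ z in l, 0 < (p z).re ∧ 0 < (g z).re :=
    (hp1.eventually_gt_atTop 0).and (hg1.eventually_gt_atTop 0)
  have hdiff : Tendsto (fun z => p z - g z) l (𝓝 0) := by
    have := hsum.const_mul (-(β : ℂ) ^ 2)
    rw [mul_zero] at this
    refine this.congr' ?_
    filter_upwards [hev] with z hz
    have hne : g z + p z ≠ 0 := fun h => by
      have := congrArg Complex.re h
      simp at this; linarith
    have h1 : g z ^ 2 = 2 * z + β ^ 2 := Complex.sqrt_sq' _
    have h2 : p z ^ 2 = 2 * z := Complex.sqrt_sq' _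
    rw [← div_eq_mul_inv, div_eq_iff hne]
    linear_combination h1 - h2
  have hratio : Tendsto (fun z => 1 - (p z - g z) * (p z)⁻¹) l (𝓝 1) := by
    have := (hdiff.mul hpi).const_sub 1
    simpa using this
  have hexp : Tendsto (fun z => Complex.exp (p z - g z + β)) l (𝓝 (Complex.exp (0 + β))) :=
    (Complex.continuous_exp.tendsto _).comp (hdiff.add_const _)
  have hfac : Tendsto (fun z => detFactor β (Complex.exp (-(g z))) (g z)⁻¹) l
      (𝓝 (detFactor β 0 0)) := by
    unfold detFactor
    exact ((he.const_add 1).add ((hgi.const_mul _).mul (he.const_sub 1))).mul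
      ((((hgi.pow 2).const_mul _).const_sub _ |>.mul (he.const_sub 1)).add
        ((hgi.const_mul _).mul (he.const_add 1)))
  have h0 : detFactor β 0 0 = (β : ℂ) + 2 := by simp [detFactor]
  have hb2 : (β : ℂ) + 2 ≠ 0 := by exact_mod_cast (by linarith : β + 2 ≠ 0)
  rw [h0] at hfac
  have hfin := ((hratio.mul hexp).const_mul 4).div hfac hb2
  have hval : 4 * (1 * Complex.exp (0 + β)) / ((β : ℂ) + 2) =
      ((4 * Real.exp β / (2 + β) : ℝ) : ℂ) := by
    push_cast
    rw [zero_add, one_mul, add_comm (2 : ℂ)]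
  rw [hval] at hfin
  refine hfin.congr' ?_
  filter_upwards [hev] with z hz
  have hg0 : g z ≠ 0 := fun h => by have := hz.2; rw [h] at this; simp at this
  have hp0 : p z ≠ 0 := fun h => by have := hz.1; rw [h] at this; simp at this
  simp only [Pi.div_apply]
  change _ = (fredholmDet β (g z))⁻¹ * Complex.exp (p z) / p z
  rw [fredholmDet_eq β hg0]
  have e1 : Complex.exp (p z - g z + β) = Complex.exp (p z) * (Complex.exp (g z - β))⁻¹ := by
    rw [← Complex.exp_neg, ← Complex.exp_add]; congr 1; ring
  rw [e1]
  have := Complex.exp_ne_zero (g z - β)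
  generalize Complex.exp (g z - β) = A at *
  generalize detFactor β (Complex.exp (-(g z))) (g z)⁻¹ = B at *
  -- A vanishing factor need not be excluded: both sides are then `0`, since division by zero gives
  -- `0`.
  rcases eq_or_ne B 0 with hB | hB
  · simp [hB]
  · field_simp
    ring

/-- Analytic continuation of the determinant formula for the Laplace transform. -/
lemma sq_mul_fredholmDet_eq_one {β : ℝ} {L : ℂ → ℂ}
    (hL : AnalyticOnNhd ℂ L {z | 0 < z.re})
    (h : ∀ s : ℝ, 0 < s → L s ^ 2 * fredholmDetReal β √(2 * s + β ^ 2) = 1) {z : ℂ}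
    (hz : 0 < z.re) : L z ^ 2 * fredholmDet β (2 * z + β ^ 2).sqrt = 1 := by
  have hre : ∀ w : ℂ, 0 < w.re → 0 < (2 * w + (β : ℂ) ^ 2).re := by
    intro w hw
    have : (2 * w + (β : ℂ) ^ 2).re = 2 * w.re + β ^ 2 := by simp [← Complex.ofReal_pow]
    rw [this]; positivity
  have hD : AnalyticOnNhd ℂ (fun z : ℂ => fredholmDet β (2 * z + β ^ 2).sqrt) {z | 0 < z.re} := by
    intro w hw
    have h1 : AnalyticAt ℂ (fun z : ℂ => (2 * z + (β : ℂ) ^ 2).sqrt) w :=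
      (Complex.analyticAt_sqrt (hre w hw)).comp (f := fun z : ℂ => 2 * z + (β : ℂ) ^ 2)
        (by fun_prop)
    have h2 : (2 * w + (β : ℂ) ^ 2).sqrt ≠ 0 := Complex.sqrt_ne_zero_of_re_pos (hre w hw)
    have h3 : AnalyticAt ℂ (fredholmDet β) (2 * w + (β : ℂ) ^ 2).sqrt := by
      rw [Complex.analyticAt_iff_eventually_differentiableAt]
      filter_upwards [isOpen_ne.mem_nhds h2] with γ hγ
      have hγ4 : γ ^ 4 ≠ 0 := pow_ne_zero _ hγ
      unfold fredholmDet
      fun_prop (disch := assumption)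
    exact h3.comp (f := fun z : ℂ => (2 * z + (β : ℂ) ^ 2).sqrt) h1
  have hU : IsPreconnected {z : ℂ | 0 < z.re} := (convex_halfSpace_re_gt 0).isPreconnected
  have key := ((hL.pow 2).mul hD).eqOn_of_preconnected_of_frequently_eq
    (analyticOnNhd_const (v := (1 : ℂ))) hU (z₀ := 1) (by simp) ?_
  · exact key hz
  -- The identity theorem needs agreement only at points accumulating at `1`, and positive reals
  -- supply them.
  · have ht : Tendsto (fun t : ℝ => (t : ℂ)) (𝓝[≠] 1) (𝓝[≠] 1) := by
      refine tendsto_nhdsWithin_iff.2 ⟨?_, ?_⟩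
      · exact ((Complex.continuous_ofReal.tendsto (1 : ℝ)).mono_left nhdsWithin_le_nhds)
      · filter_upwards [self_mem_nhdsWithin] with t ht
        intro h
        simp only [Set.mem_singleton_iff, Complex.ofReal_eq_one] at h
        exact ht h
    have hpos : ∀ᶠ t : ℝ in 𝓝[≠] 1, 0 < t := nhdsWithin_le_nhds (lt_mem_nhds one_pos)
    refine ht.frequently (Eventually.frequently ?_)
    filter_upwards [hpos] with t ht
    have e : (2 * (t : ℂ) + (β : ℂ) ^ 2).sqrt = ((√(2 * t + β ^ 2) : ℝ) : ℂ) := by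
      rw [← Complex.sqrt_ofReal (by positivity)]; push_cast; rfl
    simp only [Pi.pow_apply, e, ← ofReal_fredholmDetReal]
    exact h t ht

end SmallBall

/-! ### From the Laplace transform to the small ball probability. -/

namespace SmallBall

/-- Small ball asymptotics of a nonnegative random variable whose Laplace transform is
`(fredholmDet β √(2 s + β²))^(-1/2)`. -/
theorem tendsto_measure_le_mul_exp {Ω : Type*} [MeasurableSpace Ω] {P : Measure Ω}
    [IsProbabilityMeasure P] {S : Ω → ℝ} (hS : AEMeasurable S P) (hS0 : ∀ᵐ ω ∂P, 0 ≤ S ω)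
    {β : ℝ} (hβ : 0 < β)
    (h : ∀ s : ℝ, 0 < s → (∫ ω, Real.exp (-s * S ω) ∂P) ^ 2 *
      fredholmDetReal β √(2 * s + β ^ 2) = 1) :
    Tendsto (fun ε : ℝ => P.real {ω | S ω ≤ ε ^ 2} * Real.exp (1 / 8 * (ε ^ 2)⁻¹)) (𝓝[>] 0)
      (𝓝 (2 * √(4 * Real.exp β / (2 + β)) / √Real.pi)) := by
  set L : ℂ → ℂ := fun z => complexMGF S P (-z) with hLdef
  have hLreal : ∀ s : ℝ, L s = ((∫ ω, Real.exp (-s * S ω) ∂P : ℝ) : ℂ) := by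
    intro s
    simp only [hLdef]
    rw [← Complex.ofReal_neg, complexMGF_ofReal, mgf]
  -- As `S ≥ 0`, `exp(tS)` is bounded for `t ≤ 0`, so the complex moment generating function is
  -- analytic on the left half-plane.
  have hsub : Set.Iio (0 : ℝ) ⊆ interior (integrableExpSet S P) := by
    refine interior_maximal (fun t ht => ?_) isOpen_Iio
    have ht' : t ≤ 0 := le_of_lt ht
    refine (integrable_const (1 : ℝ)).mono' (by fun_prop) ?_
    filter_upwards [hS0] with ω hω
    rw [Real.norm_of_nonneg (Real.exp_pos _).le, Real.exp_le_one_iff]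
    exact mul_nonpos_of_nonpos_of_nonneg ht' hω
  have hLan : AnalyticOnNhd ℂ L {z | 0 < z.re} := by
    intro z hz
    have h1 : AnalyticAt ℂ (complexMGF S P) (-z) :=
      analyticAt_complexMGF (hsub (by simpa using hz))
    exact h1.comp (f := fun z : ℂ => -z) (by fun_prop)
  have hkey : ∀ z : ℂ, 0 < z.re → L z ^ 2 * fredholmDet β (2 * z + β ^ 2).sqrt = 1 := by
    intro z hz
    refine sq_mul_fredholmDet_eq_one hLan (fun s hs => ?_) hz
    rw [hLreal]
    exact_mod_cast h s hs
  set C := √(4 * Real.exp β / (2 + β)) with hC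
  have hCpos : 0 < C := Real.sqrt_pos.2 (by positivity)
  have hCsq : C ^ 2 = 4 * Real.exp β / (2 + β) := Real.sq_sqrt (by positivity)
  have hLc : ∀ c : ℝ, 0 < c → Continuous fun y : ℝ => L ((c : ℂ) + y * Complex.I) :=
    fun c hc => LaplaceInversion.continuous_complexMGF_line hS hS0 hc
  have hLn : Tendsto (normalized L) (comap Complex.re atTop) (𝓝 C) := by
    refine tendsto_normalized hCpos hLc (fun c hc => ⟨_, ?_, hLreal c⟩) ?_
    · exact integral_exp_pos (by
        refine (integrable_const (1 : ℝ)).mono' (by fun_prop) ?_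
        filter_upwards [hS0] with ω hω
        rw [Real.norm_of_nonneg (Real.exp_pos _).le, Real.exp_le_one_iff]
        nlinarith)
    · have := tendsto_fredholmDet_inv hβ
      rw [← hCsq, Complex.ofReal_pow] at this
      refine this.congr' ?_
      have hev : ∀ᶠ z in comap Complex.re atTop, 0 < z.re :=
        tendsto_comap.eventually_gt_atTop 0
      filter_upwards [hev] with z hz
      rw [← eq_inv_of_mul_eq_one_left (hkey z hz)]
  obtain ⟨hint, hlim⟩ := bromwich_asymptotics hLc hLn
  -- The substitution `p = 1/(2ε²)` gives `1/(2p) = ε²` and `p/4 = 1/(8ε²)`.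
  have hε : Tendsto (fun ε : ℝ => (2 * ε ^ 2)⁻¹) (𝓝[>] 0) atTop := by
    refine tendsto_inv_nhdsGT_zero.comp (tendsto_nhdsWithin_iff.2 ⟨?_, ?_⟩)
    · have : Tendsto (fun ε : ℝ => 2 * ε ^ 2) (𝓝 0) (𝓝 (2 * 0 ^ 2)) :=
        (by fun_prop : Continuous fun ε : ℝ => 2 * ε ^ 2).tendsto 0
      simp only [ne_eq, OfNat.ofNat_ne_zero, not_false_eq_true, zero_pow, mul_zero] at this
      exact this.mono_left nhdsWithin_le_nhds
    · filter_upwards [self_mem_nhdsWithin] with ε hε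
      simp only [Set.mem_Ioi] at hε ⊢
      positivity
  refine (hlim.comp hε).congr' ?_
  filter_upwards [hε.eventually hint, self_mem_nhdsWithin, hε.eventually_gt_atTop 0]
    with ε hi hε0 hp
  have hε0' : 0 < ε := hε0
  have hm := LaplaceInversion.measure_le_eq hS hS0 (c := ((2 * ε ^ 2)⁻¹) ^ 2 / 2)
    (by positivity) hi (1 / (2 * (2 * ε ^ 2)⁻¹))
  simp only [Function.comp]
  simp only [hLdef]
  rw [← hm]
  have e1 : 1 / (2 * (2 * ε ^ 2)⁻¹) = ε ^ 2 := by field_simp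
  have e2 : (2 * ε ^ 2)⁻¹ / 4 = 1 / 8 * (ε ^ 2)⁻¹ := by field_simp; norm_num
  rw [e1, e2]

end SmallBall

/-! ### Laplace transforms of Gaussian quadratic forms. -/

namespace GaussianQuadForm

open Matrix WithLp
open scoped RealInnerProductSpace MatrixOrder

variable {ι : Type*} [Fintype ι]

lemma integral_exp_neg_mul_sq_gaussianReal {a : ℝ} (ha : 0 ≤ a) :
    (∫ x, Real.exp (-(a * x ^ 2)) ∂(gaussianReal 0 1)) ^ 2 * (1 + 2 * a) = 1 := by
  rw [integral_gaussianReal_eq_integral_smul one_ne_zero]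
  have e : ∀ x : ℝ, gaussianPDFReal 0 1 x • Real.exp (-(a * x ^ 2))
      = (√(2 * Real.pi))⁻¹ * Real.exp (-(a + 1 / 2) * x ^ 2) := by
    intro x
    rw [gaussianPDFReal, smul_eq_mul, mul_assoc, ← Real.exp_add]
    simp only [NNReal.coe_one, mul_one, sub_zero]
    congr 2
    ring
  simp_rw [e]
  rw [integral_const_mul, integral_gaussian, mul_pow, inv_pow, Real.sq_sqrt (by positivity),
    Real.sq_sqrt (by positivity)]
  field_simp
  ring

variable {Ω : Type*} [MeasurableSpace Ω] {P : Measure Ω} {X : ι → Ω → ℝ}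

lemma integral_sq_linearCombination (hX : ∀ i, MemLp (X i) 2 P) {K : Matrix ι ι ℝ}
    (hK : ∀ i j, ∫ ω, X i ω * X j ω ∂P = K i j) (x : ι → ℝ) :
    ∫ ω, (∑ i, x i * X i ω) ^ 2 ∂P = x ⬝ᵥ K *ᵥ x := by
  have hint : ∀ i j, Integrable (fun ω => x i * X i ω * (x j * X j ω)) P := fun i j =>
    (((hX i).integrable_mul (hX j)).const_mul (x i * x j)).congr
      (Eventually.of_forall fun ω => by simp only [Pi.mul_apply]; ring)
  simp_rw [sq, Finset.sum_mul_sum]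
  rw [integral_finsetSum _ fun i _ => integrable_finsetSum _ fun j _ => hint i j]
  simp only [dotProduct, mulVec, Finset.mul_sum]
  refine Finset.sum_congr rfl fun i _ => ?_
  rw [integral_finsetSum _ fun j _ => hint i j]
  refine Finset.sum_congr rfl fun j _ => ?_
  rw [← hK, ← integral_mul_const, ← integral_const_mul]
  congr 1; ext ω; ring

lemma posSemidef_of_covariance (hX : ∀ i, MemLp (X i) 2 P) {K : Matrix ι ι ℝ}
    (hK : ∀ i j, ∫ ω, X i ω * X j ω ∂P = K i j) : K.PosSemidef := by
  refine Matrix.PosSemidef.of_dotProduct_mulVec_nonneg ?_ fun x => ?_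
  · ext i j
    rw [conjTranspose_apply, star_trivial, ← hK, ← hK]
    simp_rw [mul_comm]
  · rw [star_trivial, ← integral_sq_linearCombination hX hK]
    positivity

variable [DecidableEq ι]

/-- Since `1 + 2B = -2 (-1/2 - B)`, this is the factored characteristic polynomial evaluated at
`-1/2`. -/
lemma det_one_add_two_smul {B : Matrix ι ι ℝ} (hB : B.IsHermitian) :
    (1 + (2 : ℝ) • B).det = ∏ i, (1 + 2 * hB.eigenvalues i) := by
  have h := congrArg (Polynomial.eval (-(1 / 2) : ℝ)) hB.charpoly_eq
  rw [Matrix.eval_charpoly, Polynomial.eval_prod] at h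
  have e : 1 + (2 : ℝ) • B = (-2 : ℝ) • (Matrix.scalar ι (-(1 / 2) : ℝ) - B) := by
    ext i j
    simp [Matrix.scalar_apply, Matrix.diagonal_apply, Matrix.one_apply]
    split_ifs <;> ring
  rw [e, Matrix.det_smul, h, ← Finset.card_univ, ← Finset.prod_const, ← Finset.prod_mul_distrib]
  refine Finset.prod_congr rfl fun i _ => ?_
  simp
  ring

/-- The standard Gaussian has independent standard coordinates in any orthonormal basis. In an
eigenbasis of `B` the integral splits into one-dimensional ones. -/
lemma integral_exp_neg_quadForm_stdGaussian {B : Matrix ι ι ℝ} (hB : B.PosSemidef) :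
    (∫ x, Real.exp (-(ofLp x ⬝ᵥ B *ᵥ ofLp x)) ∂(stdGaussian (EuclideanSpace ℝ ι))) ^ 2 *
      (1 + (2 : ℝ) • B).det = 1 := by
  have hH := hB.isHermitian
  set b := hH.eigenvectorBasis with hb
  have hquad : ∀ c : ι → ℝ, ofLp (∑ i, c i • b i) ⬝ᵥ B *ᵥ ofLp (∑ i, c i • b i)
      = ∑ i, hH.eigenvalues i * c i ^ 2 := by
    intro c
    rw [← inner_toEuclideanCLM]
    have hT : ∀ i, toEuclideanCLM (𝕜 := ℝ) B (b i) = hH.eigenvalues i • b i := by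
      intro i
      apply ofLp_injective
      rw [ofLp_toEuclideanCLM, hb, hH.mulVec_eigenvectorBasis]
      rfl
    rw [map_sum]
    simp_rw [map_smul, hT, smul_smul]
    rw [b.orthonormal.inner_sum]
    refine Finset.sum_congr rfl fun i _ => ?_
    simp
    ring
  rw [stdGaussian_eq_map_pi_orthonormalBasis b, integral_map (Measurable.aemeasurable (by fun_prop))
    (by
      refine Continuous.aestronglyMeasurable ?_
      have : Continuous fun x : EuclideanSpace ℝ ι => ofLp x := PiLp.continuous_ofLp 2 _
      fun_prop)]
  simp_rw [hquad, ← Finset.sum_neg_distrib, Real.exp_sum]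
  rw [integral_fintype_prod_eq_prod (f := fun i x => Real.exp (-(hH.eigenvalues i * x ^ 2))),
    det_one_add_two_smul hH, ← Finset.prod_pow, ← Finset.prod_mul_distrib]
  exact Finset.prod_eq_one fun i _ =>
    integral_exp_neg_mul_sq_gaussianReal (hB.eigenvalues_nonneg i)

/-- Writing the vector as `R g` with `R = √K` and `g` standard replaces `M` by `R M R`. Sylvester's
identity `det(1 + AB) = det(1 + BA)` turns the determinant back into one of `M K`. -/
lemma integral_exp_neg_quadForm_multivariateGaussian {K M : Matrix ι ι ℝ} (hK : K.PosSemidef)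
    (hM : M.PosSemidef) :
    (∫ x, Real.exp (-(ofLp x ⬝ᵥ M *ᵥ ofLp x)) ∂(multivariateGaussian 0 K)) ^ 2 *
      (1 + (2 : ℝ) • (M * K)).det = 1 := by
  set R := CFC.sqrt K with hR
  have hRR : R * R = K := CFC.sqrt_mul_sqrt_self _ hK.nonneg
  have hRH : Rᵀ = R := by
    have : star R = R := (CFC.sqrt_nonneg K).isSelfAdjoint
    rwa [star_eq_conjTranspose, conjTranspose_eq_transpose_of_trivial] at this
  have hB : (R * M * R).PosSemidef := by
    have := hM.mul_mul_conjTranspose_same R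
    rwa [conjTranspose_eq_transpose_of_trivial, hRH] at this
  have hdet : (1 + (2 : ℝ) • (M * K)).det = (1 + (2 : ℝ) • (R * M * R)).det := by
    rw [← hRR, ← Matrix.mul_assoc, ← Matrix.smul_mul, Matrix.det_one_add_mul_comm, Matrix.mul_smul,
      Matrix.mul_assoc]
  have hcont : Continuous fun x : EuclideanSpace ℝ ι => ofLp x := PiLp.continuous_ofLp 2 _
  rw [hdet, ← integral_exp_neg_quadForm_stdGaussian hB, multivariateGaussian,
    integral_map (by fun_prop) (Continuous.aestronglyMeasurable (by fun_prop))]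
  congr 3
  ext x
  rw [zero_add, ofLp_toEuclideanCLM, ← hR]
  congr 2
  rw [← Matrix.mulVec_mulVec, ← Matrix.mulVec_mulVec, Matrix.dotProduct_mulVec (ofLp x) R,
    ← Matrix.mulVec_transpose, hRH]

lemma map_eq_multivariateGaussian (hX : HasGaussianLaw (fun ω i => X i ω) P)
    (h0 : ∀ i, ∫ ω, X i ω ∂P = 0) {K : Matrix ι ι ℝ}
    (hK : ∀ i j, ∫ ω, X i ω * X j ω ∂P = K i j) :
    P.map (fun ω => toLp 2 fun i => X i ω) = multivariateGaussian 0 K := by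
  have hP := hX.isProbabilityMeasure
  have hXi : ∀ i, MemLp (X i) 2 P := fun i => (hX.eval i).memLp_two
  have hKp := posSemidef_of_covariance hXi hK
  have hY : HasGaussianLaw (fun ω => toLp 2 fun i => X i ω) P := hX.toLp_pi 2
  apply Measure.ext_of_charFun
  ext t
  rw [charFun_multivariateGaussian hKp, hY.charFun_map_eq]
  have hin : ∀ ω, ⟪t, toLp 2 fun i => X i ω⟫ = ∑ i, t i * X i ω := by
    intro ω
    simp [PiLp.inner_apply, mul_comm]
  have hmean : ∫ ω, ∑ i, t i * X i ω ∂P = 0 := by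
    rw [integral_finsetSum _ fun i _ => ((hXi i).integrable one_le_two).const_mul _]
    simp [integral_const_mul, h0]
  have hvar : Var[fun ω => ∑ i, t i * X i ω; P] = ofLp t ⬝ᵥ K *ᵥ ofLp t := by
    rw [variance_of_integral_eq_zero ?_ hmean]
    · exact integral_sq_linearCombination hXi hK _
    · exact (integrable_finsetSum _ fun i _ =>
        ((hXi i).integrable one_le_two).const_mul _).aemeasurable
  simp_rw [hin]
  rw [hvar, hmean]
  simp

/-- Laplace transform of a nonnegative quadratic form of a centred Gaussian vector. -/
theorem integral_exp_neg_quadForm (hX : HasGaussianLaw (fun ω i => X i ω) P)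
    (h0 : ∀ i, ∫ ω, X i ω ∂P = 0) {K M : Matrix ι ι ℝ}
    (hK : ∀ i j, ∫ ω, X i ω * X j ω ∂P = K i j) (hM : M.PosSemidef) :
    (∫ ω, Real.exp (-((fun i => X i ω) ⬝ᵥ M *ᵥ fun i => X i ω)) ∂P) ^ 2 *
      (1 + (2 : ℝ) • (M * K)).det = 1 := by
  have hKp := posSemidef_of_covariance (fun i => (hX.eval i).memLp_two) hK
  have hY : HasGaussianLaw (fun ω => toLp 2 fun i => X i ω) P := hX.toLp_pi 2
  have hcont : Continuous fun x : EuclideanSpace ℝ ι => ofLp x := PiLp.continuous_ofLp 2 _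
  rw [← integral_exp_neg_quadForm_multivariateGaussian hKp hM,
    ← map_eq_multivariateGaussian hX h0 hK,
    integral_map hY.aemeasurable (Continuous.aestronglyMeasurable (by fun_prop))]

end GaussianQuadForm

/-! ### Determinants and linear systems for the matrix `ρ^|i-j|`. -/

namespace AutoregressiveMatrix

open Matrix

/-- The autoregressive correlation matrix `ρ^|i-j|`. -/
def corr (ρ : ℝ) (n : ℕ) : Matrix (Fin n) (Fin n) ℝ :=
  Matrix.of fun i j => ρ ^ ((i : ℕ) - (j : ℕ) + ((j : ℕ) - (i : ℕ)))

/-- Subtracting `ρ` times row `1` from row `0`, and likewise for columns, uses the Markov property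
`ρ^j = ρ · ρ^(j-1)`. Row and column `0` then have only two nonzero entries near the corner, and
Laplace expansion gives a continuant recurrence. -/
lemma det_one_add_corr_succ_succ (κ ρ : ℝ) (n : ℕ) :
    (1 + κ • corr ρ (n + 2)).det = (1 + ρ ^ 2 + κ * (1 - ρ ^ 2)) * (1 + κ • corr ρ (n + 1)).det
      - ρ ^ 2 * (1 + κ • corr ρ n).det := by
  set A := 1 + κ • corr ρ (n + 2) with hA
  have hAij : ∀ i j, A i j = (if i = j then 1 else 0) +
      κ * ρ ^ ((i : ℕ) - (j : ℕ) + ((j : ℕ) - (i : ℕ))) := by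
    intro i j
    simp [hA, corr, Matrix.one_apply]
  set A' := A.updateRow 0 (A 0 + (-ρ) • A 1) with hA'
  set N := A'.updateCol 0 (fun k => A' k 0 + (-ρ) • A' k 1) with hN
  have h1 : N.det = A.det := by
    rw [hN, det_updateCol_add_smul_self _ (by simp), hA', det_updateRow_add_smul_self _ (by simp)]
  have hN00 : N 0 0 = 1 + ρ ^ 2 + κ * (1 - ρ ^ 2) := by
    simp [hN, hA', hAij]
    ring
  have hN01 : N 0 (Fin.succ 0) = -ρ := by
    simp [hN, hA', hAij]
    ring
  have hN10 : N (Fin.succ 0) 0 = -ρ := by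
    simp [hN, hA', hAij]
    ring
  have hN0 : ∀ j : Fin n, N 0 j.succ.succ = 0 := by
    intro j
    have hne : (1 : Fin (n + 2)) ≠ j.succ.succ := by simp [Fin.ext_iff]
    have hne' : (0 : Fin (n + 2)) ≠ j.succ.succ := by simp [Fin.ext_iff]
    simp [hN, hA', hAij, hne, hne', hne'.symm]
    ring
  have hN0' : ∀ i : Fin n, N i.succ.succ 0 = 0 := by
    intro i
    have hne : (1 : Fin (n + 2)) ≠ i.succ.succ := by simp [Fin.ext_iff]
    have hne' : (0 : Fin (n + 2)) ≠ i.succ.succ := by simp [Fin.ext_iff]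
    simp [hN, hA', hAij, updateRow_apply, hne.symm, hne'.symm]
    ring
  have hNs : ∀ i j : Fin (n + 1), N i.succ j.succ = A i.succ j.succ := by
    intro i j
    simp [hN, hA', updateRow_apply]
  have hAs : ∀ i j : Fin (n + 1), A i.succ j.succ = (1 + κ • corr ρ (n + 1)) i j := by
    intro i j
    rw [hAij]
    simp [corr, Matrix.one_apply]
  have hAss : ∀ i j : Fin n, A i.succ.succ j.succ.succ = (1 + κ • corr ρ n) i j := by
    intro i j
    rw [hAij]
    simp [corr, Matrix.one_apply]
  rw [← h1, det_succ_row_zero, Fin.sum_univ_succ, Fin.sum_univ_succ]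
  simp only [hN0, hN00, hN01, mul_zero, zero_mul, Finset.sum_const_zero, add_zero]
  have e1 : N.submatrix Fin.succ (Fin.succAbove 0) = 1 + κ • corr ρ (n + 1) := by
    ext i j
    rw [submatrix_apply, Fin.succAbove_zero, hNs, hAs]
  have e2 : (N.submatrix Fin.succ (Fin.succAbove (Fin.succ 0))).det
      = -ρ * (1 + κ • corr ρ n).det := by
    rw [det_succ_column_zero, Fin.sum_univ_succ]
    have z : ∀ i : Fin n, N.submatrix Fin.succ (Fin.succAbove (Fin.succ 0)) i.succ 0 = 0 := by
      intro i
      rw [submatrix_apply, Fin.succ_succAbove_zero, hN0']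
    simp only [z, mul_zero, zero_mul, Finset.sum_const_zero, add_zero]
    rw [submatrix_apply, Fin.succ_succAbove_zero, hN10]
    have e3 : (N.submatrix Fin.succ (Fin.succAbove (Fin.succ 0))).submatrix (Fin.succAbove 0)
        Fin.succ = 1 + κ • corr ρ n := by
      ext i j
      rw [submatrix_apply, submatrix_apply, Fin.succ_succAbove_succ, Fin.succAbove_zero,
        hNs, hAss]
    rw [e3]
    simp
  rw [e1, e2]
  simp
  ring

/-- Here `u` and `v` are the roots of the characteristic equation of the recurrence, and the
coefficients match the determinants `1` and `1 + κ` of sizes `0` and `1`. -/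
lemma det_one_add_corr {κ ρ u v : ℝ} (huv : u * v = ρ ^ 2)
    (hsum : u + v = 1 + ρ ^ 2 + κ * (1 - ρ ^ 2)) (n : ℕ) :
    (u - v) * (1 + κ • corr ρ n).det = (1 + κ - v) * u ^ n + (u - 1 - κ) * v ^ n := by
  induction n using Nat.twoStepInduction with
  | zero => simp; ring
  | one =>
    rw [det_unique]
    simp [corr]
    ring
  | more n h0 h1 =>
    rw [det_one_add_corr_succ_succ, ← hsum, ← huv]
    linear_combination (u + v) * h1 - u * v * h0

/-- Quadratic form of the centred sum of squares `∑ (xᵢ - x̄)²`. -/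
noncomputable def centering (n : ℕ) : Matrix (Fin n) (Fin n) ℝ :=
  1 - (n : ℝ)⁻¹ • Matrix.of fun _ _ => 1

lemma centering_quadForm {n : ℕ} (x : Fin n → ℝ) :
    x ⬝ᵥ centering n *ᵥ x = ∑ i, x i ^ 2 - (n : ℝ)⁻¹ * (∑ i, x i) ^ 2 := by
  have e : (Matrix.of fun (_ _ : Fin n) => (1 : ℝ)) *ᵥ x = fun _ => ∑ i, x i := by
    ext i; simp [mulVec, dotProduct]
  rw [centering, sub_mulVec, one_mulVec, smul_mulVec, e, dotProduct_sub, dotProduct_smul]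
  simp only [dotProduct, smul_eq_mul, ← Finset.sum_mul]
  congr 1
  · exact Finset.sum_congr rfl fun i _ => (sq _).symm
  · rw [sq]

lemma posSemidef_centering (n : ℕ) : (centering n).PosSemidef := by
  refine Matrix.PosSemidef.of_dotProduct_mulVec_nonneg ?_ fun x => ?_
  · ext i j
    simp [centering, Matrix.one_apply, eq_comm]
  · rw [star_trivial, centering_quadForm, sub_nonneg]
    rcases Nat.eq_zero_or_pos n with rfl | hn
    · simp
    · rw [inv_mul_le_iff₀ (by exact_mod_cast hn)]
      simpa using sq_sum_le_card_mul_sum_sq (s := Finset.univ) (f := x)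

/-- If `T f = 1` then centering multiplies the determinant by the mean of `f`. -/
lemma det_one_add_centering_mul {n : ℕ} (hn : 0 < n) {B : Matrix (Fin n) (Fin n) ℝ}
    (hT : (1 + B).det ≠ 0) {f : Fin n → ℝ} (hf : (1 + B) *ᵥ f = 1) :
    (1 + centering n * B).det = (1 + B).det * ((n : ℝ)⁻¹ * ∑ i, f i) := by
  set T := 1 + B with hTdef
  have hu : IsUnit T.det := isUnit_iff_ne_zero.2 hT
  set J : Matrix (Fin n) (Fin n) ℝ := Matrix.of fun _ _ => 1 with hJ
  set r : Fin n → ℝ := (n : ℝ)⁻¹ • ((1 : Fin n → ℝ) ᵥ* T⁻¹ - 1) with hr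
  have hnn : (n : ℝ) ≠ 0 := by exact_mod_cast hn.ne'
  have hcr : ∀ w : Fin n → ℝ, replicateCol Unit (1 : Fin n → ℝ) * replicateRow Unit w
      = Matrix.of fun _ j => w j := by
    intro w; ext i j; simp [Matrix.mul_apply]
  have hJT : J * T⁻¹ = Matrix.of fun _ j => ((1 : Fin n → ℝ) ᵥ* T⁻¹) j := by
    ext i j; simp [hJ, Matrix.mul_apply, vecMul, dotProduct]
  -- Substituting `B = T - 1` in `T - n⁻¹ J B` exhibits a rank-one perturbation of the identity
  -- times `T`, to which the matrix determinant lemma applies.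
  have hfac : 1 + centering n * B = (1 + replicateCol Unit (1 : Fin n → ℝ) * replicateRow Unit r)
      * T := by
    have e : (replicateCol Unit (1 : Fin n → ℝ) * replicateRow Unit r)
        = (n : ℝ)⁻¹ • (J * T⁻¹ - J) := by
      rw [hcr, hJT]
      ext i j
      simp [hr, hJ]
    rw [e, Matrix.add_mul, Matrix.smul_mul, Matrix.sub_mul, Matrix.mul_assoc, nonsing_inv_mul _ hu,
      hTdef, centering, ← hJ]
    simp only [Matrix.sub_mul, Matrix.mul_add, Matrix.mul_one, Matrix.one_mul, Matrix.smul_mul]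
    ext i j
    simp
    ring
  have hinv : T⁻¹ *ᵥ 1 = f := by
    rw [← hf, mulVec_mulVec, nonsing_inv_mul _ hu, one_mulVec]
  rw [hfac, det_mul, det_one_add_replicateCol_mul_replicateRow, mul_comm]
  congr 1
  rw [hr, smul_dotProduct, sub_dotProduct, ← dotProduct_mulVec, hinv]
  simp [dotProduct]
  field_simp
  ring

/-- The sum splits at `j = i` into two geometric sums. The denominators are cleared so that it can
be used for `x = 1` too. -/
lemma sum_corr_mul {ρ x : ℝ} (n : ℕ) (i : Fin n) :
    (x - ρ) * (1 - ρ * x) * ∑ j, corr ρ n i j * x ^ (j : ℕ) =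
      x ^ ((i : ℕ) + 1) * (1 - ρ ^ 2) - ρ ^ ((i : ℕ) + 1) * (1 - ρ * x)
        - ρ ^ (n - i) * x ^ n * (x - ρ) := by
  have hfin : ∑ j, corr ρ n i j * x ^ (j : ℕ)
      = ∑ j ∈ Finset.range n, ρ ^ ((i : ℕ) - j + (j - (i : ℕ))) * x ^ j := by
    rw [Finset.sum_range]; simp [corr]
  obtain ⟨m, hm⟩ : ∃ m, n = (i : ℕ) + m := ⟨n - i, by omega⟩
  rw [hfin]
  generalize (i : ℕ) = k at hm ⊢
  subst hm
  rw [Finset.sum_range_add]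
  have e1 : ∑ j ∈ Finset.range k, ρ ^ (k - j + (j - k)) * x ^ j
      = ρ * ∑ j ∈ Finset.range k, x ^ j * ρ ^ (k - 1 - j) := by
    rw [Finset.mul_sum]
    refine Finset.sum_congr rfl fun j hj => ?_
    have hj' := Finset.mem_range.1 hj
    have : k - j + (j - k) = (k - 1 - j) + 1 := by omega
    rw [this]; ring
  have e2 : ∑ j ∈ Finset.range m, ρ ^ (k - (k + j) + (k + j - k)) * x ^ (k + j)
      = x ^ k * ∑ j ∈ Finset.range m, (ρ * x) ^ j := by
    rw [Finset.mul_sum]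
    refine Finset.sum_congr rfl fun j _ => ?_
    have : k - (k + j) + (k + j - k) = j := by omega
    rw [this]; ring
  have g1 : (∑ j ∈ Finset.range k, x ^ j * ρ ^ (k - 1 - j)) * (x - ρ) = x ^ k - ρ ^ k :=
    (Commute.all x ρ).geom_sum₂_mul k
  have g2 : (∑ j ∈ Finset.range m, (ρ * x) ^ j) * (ρ * x - 1) = (ρ * x) ^ m - 1 :=
    geom_sum_mul _ _
  rw [e1, e2, Nat.add_sub_cancel_left]
  rw [mul_pow] at g2
  linear_combination ρ * (1 - ρ * x) * g1 - x ^ k * (x - ρ) * g2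

/-- The explicit solution of `(1 + κ ρ^|i-j|) f = 1`. -/
lemma one_add_corr_mulVec_eq_one {ρ x κ a b : ℝ} (hρ : ρ ≠ 1) (h1 : x ≠ ρ) (h2 : ρ * x ≠ 1)
    (hκ : κ * (x * (1 - ρ ^ 2)) = (x - ρ) * (ρ * x - 1)) {n : ℕ}
    (ha : a * (1 + κ * ((1 + ρ) / (1 - ρ))) = 1)
    (hb : a / (1 - ρ) + b * (1 / (x - ρ) + x ^ n / (1 - ρ * x)) = 0) :
    (1 + κ • corr ρ n) *ᵥ (fun j : Fin n => a + b * (x ^ (j : ℕ) + x ^ (n - 1 - (j : ℕ)))) = 1 := by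
  have d1 : x - ρ ≠ 0 := sub_ne_zero.2 h1
  have d2 : 1 - ρ * x ≠ 0 := sub_ne_zero.2 (Ne.symm h2)
  have d3 : 1 - ρ ≠ 0 := sub_ne_zero.2 (Ne.symm hρ)
  ext i
  have hi := i.2
  have s1 := sum_corr_mul (ρ := ρ) (x := 1) n i
  have s2 := sum_corr_mul (ρ := ρ) (x := x) n i
  have s3 := sum_corr_mul (ρ := ρ) (x := x) n (Fin.rev i)
  have hrev : ∑ j, corr ρ n (Fin.rev i) j * x ^ (j : ℕ)
      = ∑ j, corr ρ n i j * x ^ (n - 1 - (j : ℕ)) := by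
    rw [← Equiv.sum_comp Fin.revPerm]
    refine Finset.sum_congr rfl fun j _ => ?_
    have hj := j.2
    simp only [corr, of_apply, Fin.revPerm_apply, Fin.val_rev]
    congr 2 <;> omega
  rw [hrev] at s3
  simp only [Fin.val_rev] at s3
  have n1 : n - ((i : ℕ) + 1) + 1 = n - i := by omega
  have n2 : n - (n - ((i : ℕ) + 1)) = i + 1 := by omega
  have n3 : n - 1 - (i : ℕ) + 1 = n - i := by omega
  rw [n1, n2] at s3
  simp only [one_pow, mul_one] at s1
  have lhs : ((1 + κ • corr ρ n) *ᵥ (fun j : Fin n => a + b * (x ^ (j : ℕ) + x ^ (n - 1 - (j : ℕ))))) i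
      = a + b * (x ^ (i : ℕ) + x ^ (n - 1 - (i : ℕ))) + κ * (a * (∑ j, corr ρ n i j) +
        b * (∑ j, corr ρ n i j * x ^ (j : ℕ)) +
        b * (∑ j, corr ρ n i j * x ^ (n - 1 - (j : ℕ)))) := by
    rw [Matrix.add_mulVec, Matrix.one_mulVec, Matrix.smul_mulVec]
    simp only [Pi.add_apply, Pi.smul_apply, smul_eq_mul, mulVec, dotProduct, Finset.mul_sum,
      ← Finset.sum_add_distrib]
    congr 1
    refine Finset.sum_congr rfl fun j _ => ?_
    ring
  rw [lhs, Pi.one_apply]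
  have x3 : x ^ (n - (i : ℕ)) = x ^ (n - 1 - (i : ℕ)) * x := by rw [← pow_succ, n3]
  rw [x3] at s3
  generalize x ^ (n - 1 - (i : ℕ)) = Y at *
  rw [pow_succ x (i : ℕ)] at s2
  generalize x ^ (i : ℕ) = X at *
  generalize ∑ j, corr ρ n i j = S1 at *
  generalize ∑ j, corr ρ n i j * x ^ (j : ℕ) = S2 at *
  generalize ∑ j, corr ρ n i j * x ^ (n - 1 - (j : ℕ)) = S3 at *
  generalize ρ ^ ((i : ℕ) + 1) = p at *
  generalize ρ ^ (n - (i : ℕ)) = q at *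
  generalize x ^ n = Z at *
  have r1 : S1 = (1 - ρ ^ 2 - p * (1 - ρ) - q * (1 - ρ)) / ((1 - ρ) * (1 - ρ)) := by
    rw [eq_div_iff (mul_ne_zero d3 d3)]; linear_combination s1
  have t1 : S1 = (1 + ρ) / (1 - ρ) - (p + q) * (1 / (1 - ρ)) := by
    rw [r1]; field_simp; ring
  have hdiv : ∀ {A B : ℝ}, A ≠ 0 → B ≠ 0 → ∀ p q : ℝ,
      A * B * (p / A + q * (Z / B)) = p * B + q * Z * A := by
    intro A B hA hB p q
    field_simp
  have t2 : κ * S2 = -X - κ * (p / (x - ρ) + q * (Z / (1 - ρ * x))) := by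
    refine mul_left_cancel₀ (mul_ne_zero d1 d2) ?_
    linear_combination κ * s2 + X * hκ + κ * hdiv d1 d2 p q
  have t3 : κ * S3 = -Y - κ * (q / (x - ρ) + p * (Z / (1 - ρ * x))) := by
    refine mul_left_cancel₀ (mul_ne_zero d1 d2) ?_
    linear_combination κ * s3 + Y * hκ + κ * hdiv d1 d2 q p
  rw [t1]
  -- `hκ` has made the terms in `x^i` and `x^(n-1-i)` cancel, and `ha` settles the constant. The
  -- boundary terms `p = ρ^(i+1)` and `q = ρ^(n-i)` carry, by the reflection symmetry of the ansatz,
  -- the same coefficient, which `hb` annihilates.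
  linear_combination ha + b * t2 + b * t3 - κ * (p + q) * hb

end AutoregressiveMatrix

/-! ### Continuum limit of the determinants. -/

namespace AutoregressiveMatrix

open Matrix

lemma tendsto_nat_mul_exp_div_sub_one (c : ℝ) :
    Tendsto (fun n : ℕ => (n : ℝ) * (Real.exp (c / n) - 1)) atTop (𝓝 c) := by
  have hd : HasDerivAt (fun t : ℝ => Real.exp (c * t)) c 0 := by
    simpa using ((hasDerivAt_id (0 : ℝ)).const_mul c).exp
  have h1 : Tendsto (fun n : ℕ => ((n : ℝ))⁻¹) atTop (𝓝[≠] 0) := by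
    refine tendsto_nhdsWithin_iff.2 ⟨tendsto_inv_atTop_nhds_zero_nat, ?_⟩
    filter_upwards [eventually_gt_atTop 0] with n hn
    have : (n : ℝ) ≠ 0 := by exact_mod_cast hn.ne'
    simpa using this
  refine (hd.tendsto_slope_zero.comp h1).congr fun n => ?_
  simp [div_eq_mul_inv]

lemma tendsto_exp_div_nat (c : ℝ) :
    Tendsto (fun n : ℕ => Real.exp (c / n)) atTop (𝓝 1) := by
  rw [← Real.exp_zero]
  exact (Real.continuous_exp.tendsto 0).comp (tendsto_const_div_atTop_nhds_zero_nat c)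

/-- On the left stands the limit as the discretization yields it: the limit of `det(1 + κ ρ^|i-j|)`
times the limiting mean of the explicit solution. The denominator of the second factor divides the
first, so it cancels. -/
lemma fredholmDetReal_eq {β γ : ℝ} (hβ : 0 < β) (hγ : β < γ) :
    (((γ ^ 2 - β ^ 2) / (2 * β) + (γ + β)) * Real.exp (γ - β) +
      ((γ - β) - (γ ^ 2 - β ^ 2) / (2 * β)) * Real.exp (-γ - β)) / (2 * γ) *
    (β ^ 2 / γ ^ 2 + 2 * (-(β ^ 2 / γ ^ 2 / β) /
      (1 / (γ + β) - Real.exp γ / (γ - β))) * (Real.exp γ - 1) / γ)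
    = SmallBall.fredholmDetReal β γ := by
  have hγ0 : 0 < γ := hβ.trans hγ
  have hsub : 0 < γ - β := sub_pos.2 hγ
  have e1 : Real.exp (γ - β) = Real.exp (γ / 2) ^ 2 * Real.exp (-β) := by
    rw [← Real.exp_nat_mul, ← Real.exp_add]; congr 1; push_cast; ring
  have e2 : Real.exp (-γ - β) = (Real.exp (γ / 2) ^ 2)⁻¹ * Real.exp (-β) := by
    rw [← Real.exp_nat_mul, ← Real.exp_neg, ← Real.exp_add]; congr 1; push_cast; ring
  have e4 : Real.exp γ = Real.exp (γ / 2) ^ 2 := by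
    rw [← Real.exp_nat_mul]; congr 1; push_cast; ring
  have e3 : Real.exp (-(γ / 2)) = (Real.exp (γ / 2))⁻¹ := Real.exp_neg _
  have hE : 1 < Real.exp (γ / 2) := Real.one_lt_exp_iff.2 (by positivity)
  rw [SmallBall.fredholmDetReal, Real.cosh_eq, Real.sinh_eq, e1, e2, e3, e4]
  generalize Real.exp (γ / 2) = E at *
  generalize Real.exp (-β) = B at *
  have hE0 : E ≠ 0 := by positivity
  have hden : (γ - β) - E ^ 2 * (γ + β) ≠ 0 := by
    have : 1 < E ^ 2 := by nlinarith
    nlinarith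
  have hsum : γ + β ≠ 0 := by positivity
  have hd : 1 / (γ + β) - E ^ 2 / (γ - β) = ((γ - β) - E ^ 2 * (γ + β)) / ((γ + β) * (γ - β)) := by
    rw [div_sub_div _ _ hsum hsub.ne']; ring
  have hs : γ - β ≠ 0 := hsub.ne'
  rw [hd]
  generalize hD : (γ - β) - E ^ 2 * (γ + β) = D at *
  have hb : 2 * (-(β ^ 2 / γ ^ 2 / β) / (D / ((γ + β) * (γ - β)))) * (E ^ 2 - 1) / γ
      = -(2 * β * (γ ^ 2 - β ^ 2) * (E ^ 2 - 1)) / (γ ^ 3 * D) := by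
    field_simp
    ring
  have hc : ((γ ^ 2 - β ^ 2) / (2 * β) + (γ + β)) * (E ^ 2 * B) +
      ((γ - β) - (γ ^ 2 - β ^ 2) / (2 * β)) * ((E ^ 2)⁻¹ * B)
      = -(B * D * (E ^ 2 * (γ + β) + (γ - β))) / (2 * β * E ^ 2) := by
    rw [← hD]
    field_simp
    ring
  rw [hb, hc]
  field_simp
  rw [← hD]
  ring

/-- Discretized Fredholm determinants: with the weights `κ n`, the determinants can be evaluated in
closed form and converge. -/
theorem exists_weights {β γ : ℝ} (hβ : 0 < β) (hγ : β < γ) :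
    ∃ κ : ℕ → ℝ, (∀ᶠ n in atTop, 0 ≤ κ n) ∧
      Tendsto (fun n : ℕ => (n : ℝ) * κ n) atTop (𝓝 ((γ ^ 2 - β ^ 2) / (2 * β))) ∧
      Tendsto (fun n : ℕ => (1 + centering n * (κ n • corr (Real.exp (-β / n)) n)).det) atTop
        (𝓝 (SmallBall.fredholmDetReal β γ)) := by
  have hγ0 : 0 < γ := hβ.trans hγ
  have hsub : 0 < γ - β := sub_pos.2 hγ
  set ρ : ℕ → ℝ := fun n => Real.exp (-β / n) with hρ
  set x : ℕ → ℝ := fun n => Real.exp (γ / n) with hx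
  -- `κ` is tuned so that the roots of the recurrence are exactly `ρ x = exp((γ-β)/n)` and `ρ/x =
  -- exp(-(γ+β)/n)`. Their `n`-th powers do not depend on `n`, so only first-order limits of
  -- exponentials remain.
  set κ : ℕ → ℝ := fun n => (x n - ρ n) * (ρ n * x n - 1) / (x n * (1 - ρ n ^ 2)) with hκ
  have ρx : ∀ n, ρ n * x n = Real.exp ((γ - β) / n) := fun n => by
    simp only [hρ, hx]; rw [← Real.exp_add]; congr 1; ring
  have ρ2 : ∀ n, ρ n ^ 2 = Real.exp (-(2 * β) / n) := fun n => by
    simp only [hρ]; rw [← Real.exp_nat_mul]; congr 1; push_cast; ring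
  have ρdx : ∀ n, ρ n / x n = Real.exp ((-γ - β) / n) := fun n => by
    simp only [hρ, hx]; rw [← Real.exp_sub]; congr 1; ring
  have hx0 : ∀ n, x n ≠ 0 := fun n => (Real.exp_pos _).ne'
  have tx : Tendsto x atTop (𝓝 1) := tendsto_exp_div_nat γ
  have tρ : Tendsto ρ atTop (𝓝 1) := tendsto_exp_div_nat (-β)
  have t1 : Tendsto (fun n : ℕ => (n : ℝ) * (x n - ρ n)) atTop (𝓝 (γ + β)) := by
    have := (tendsto_nat_mul_exp_div_sub_one γ).sub (tendsto_nat_mul_exp_div_sub_one (-β))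
    rw [sub_neg_eq_add] at this
    exact this.congr fun n => by simp only [hx, hρ]; ring
  have t2 : Tendsto (fun n : ℕ => (n : ℝ) * (ρ n * x n - 1)) atTop (𝓝 (γ - β)) := by
    simp_rw [ρx]; exact tendsto_nat_mul_exp_div_sub_one _
  have t3 : Tendsto (fun n : ℕ => (n : ℝ) * (1 - ρ n ^ 2)) atTop (𝓝 (2 * β)) := by
    have := (tendsto_nat_mul_exp_div_sub_one (-(2 * β))).neg
    rw [neg_neg] at this
    exact this.congr fun n => by rw [ρ2]; ring
  have t4 : Tendsto (fun n : ℕ => (n : ℝ) * (1 - ρ n)) atTop (𝓝 β) := by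
    have := (tendsto_nat_mul_exp_div_sub_one (-β)).neg
    rw [neg_neg] at this
    exact this.congr fun n => by simp only [hρ]; ring
  have t5 : Tendsto (fun n : ℕ => (n : ℝ) * (1 - ρ n / x n)) atTop (𝓝 (γ + β)) := by
    have := (tendsto_nat_mul_exp_div_sub_one (-γ - β)).neg
    have e : -(-γ - β) = γ + β := by ring
    rw [e] at this
    exact this.congr fun n => by rw [ρdx]; ring
  have t6 : Tendsto (fun n : ℕ => (n : ℝ) * (x n - 1)) atTop (𝓝 γ) :=
    tendsto_nat_mul_exp_div_sub_one γ
  have tκ : Tendsto (fun n : ℕ => (n : ℝ) * κ n) atTop (𝓝 ((γ ^ 2 - β ^ 2) / (2 * β))) := by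
    have := (t1.mul t2).div (tx.mul t3) (by positivity)
    have e : (γ + β) * (γ - β) / (1 * (2 * β)) = (γ ^ 2 - β ^ 2) / (2 * β) := by ring
    rw [e] at this
    refine this.congr' ?_
    filter_upwards [eventually_gt_atTop 0] with n hn
    have hn' : (n : ℝ) ≠ 0 := by exact_mod_cast hn.ne'
    simp only [Pi.div_apply, hκ]
    rw [mul_mul_mul_comm, mul_left_comm (x n), mul_assoc, mul_div_mul_left _ _ hn', mul_div_assoc]
  have hpown : ∀ c : ℝ, ∀ n : ℕ, 0 < n → Real.exp (c / n) ^ n = Real.exp c := by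
    intro c n hn
    have hn' : (n : ℝ) ≠ 0 := by exact_mod_cast hn.ne'
    rw [← Real.exp_nat_mul, mul_div_cancel₀ _ hn']
  have hρ1 : ∀ᶠ n : ℕ in atTop, ρ n < 1 := by
    filter_upwards [eventually_gt_atTop 0] with n hn
    have hn' : (0 : ℝ) < n := by exact_mod_cast hn
    exact Real.exp_lt_one_iff.2 (div_neg_of_neg_of_pos (neg_neg_of_pos hβ) hn')
  have hx1 : ∀ᶠ n : ℕ in atTop, 1 < x n := by
    filter_upwards [eventually_gt_atTop 0] with n hn
    have hn' : (0 : ℝ) < n := by exact_mod_cast hn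
    exact Real.one_lt_exp_iff.2 (by positivity)
  have hρx1 : ∀ᶠ n : ℕ in atTop, 1 < ρ n * x n := by
    filter_upwards [eventually_gt_atTop 0] with n hn
    have hn' : (0 : ℝ) < n := by exact_mod_cast hn
    rw [ρx]
    exact Real.one_lt_exp_iff.2 (by positivity)
  have hκeq : ∀ᶠ n : ℕ in atTop, κ n * (x n * (1 - ρ n ^ 2)) = (x n - ρ n) * (ρ n * x n - 1) := by
    filter_upwards [hρ1] with n h1
    have : 1 - ρ n ^ 2 ≠ 0 := by
      have : 0 < ρ n := Real.exp_pos _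
      nlinarith
    exact div_mul_cancel₀ _ (mul_ne_zero (hx0 n) this)
  -- determinant before centering
  have tD : Tendsto (fun n : ℕ => (1 + κ n • corr (ρ n) n).det) atTop
      (𝓝 ((((γ ^ 2 - β ^ 2) / (2 * β) + (γ + β)) * Real.exp (γ - β) +
      ((γ - β) - (γ ^ 2 - β ^ 2) / (2 * β)) * Real.exp (-γ - β)) / (2 * γ))) := by
    have hden : Tendsto (fun n : ℕ => (n : ℝ) * (ρ n * x n - 1) + (n : ℝ) * (1 - ρ n / x n)) atTop
        (𝓝 (2 * γ)) := by
      have := t2.add t5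
      have e : γ - β + (γ + β) = 2 * γ := by ring
      rwa [e] at this
    have := (((tκ.add t5).mul_const (Real.exp (γ - β))).add
      ((t2.sub tκ).mul_const (Real.exp (-γ - β)))).div hden (by positivity)
    refine this.congr' ?_
    filter_upwards [eventually_gt_atTop 0, hκeq, hx1, hρx1] with n hn hk h1 h2
    have hn' : (n : ℝ) ≠ 0 := by exact_mod_cast hn.ne'
    have hv : ρ n / x n < 1 := by
      rw [ρdx]
      have hn' : (0 : ℝ) < n := by exact_mod_cast hn
      exact Real.exp_lt_one_iff.2 (div_neg_of_neg_of_pos (by linarith) hn')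
    have key := det_one_add_corr (κ := κ n) (ρ := ρ n) (u := ρ n * x n) (v := ρ n / x n)
      (by field_simp [hx0 n]) (by
        have : ρ n / x n * x n = ρ n := div_mul_cancel₀ _ (hx0 n)
        refine mul_left_cancel₀ (hx0 n) ?_
        linear_combination this - hk) n
    rw [ρx n, ρdx n, hpown _ n hn, hpown _ n hn, ← ρx n, ← ρdx n] at key
    simp only [Pi.div_apply]
    have hne : (n : ℝ) * (ρ n * x n - 1) + (n : ℝ) * (1 - ρ n / x n) ≠ 0 := by
      rw [← mul_add]
      refine mul_ne_zero hn' ?_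
      linarith
    rw [div_eq_iff hne]
    linear_combination -(n : ℝ) * key
  set D0 := (((γ ^ 2 - β ^ 2) / (2 * β) + (γ + β)) * Real.exp (γ - β) +
      ((γ - β) - (γ ^ 2 - β ^ 2) / (2 * β)) * Real.exp (-γ - β)) / (2 * γ) with hD0
  -- The nonzero limit makes the uncentered matrix invertible for large `n`, as the rank-one formula
  -- requires.
  have hD0pos : 0 < D0 := by
    have e1 : (γ ^ 2 - β ^ 2) / (2 * β) + (γ + β) = (γ + β) ^ 2 / (2 * β) := by field_simp; ring
    have e2 : (γ - β) - (γ ^ 2 - β ^ 2) / (2 * β) = -((γ - β) ^ 2 / (2 * β)) := by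
      field_simp; ring
    have h1 : Real.exp (-γ - β) < Real.exp (γ - β) := Real.exp_lt_exp.2 (by linarith)
    have h2 : (γ - β) ^ 2 / (2 * β) ≤ (γ + β) ^ 2 / (2 * β) := by
      gcongr; linarith
    have h3 : 0 < (γ + β) ^ 2 / (2 * β) := by positivity
    have h4 : (γ - β) ^ 2 / (2 * β) * Real.exp (-γ - β)
        < (γ + β) ^ 2 / (2 * β) * Real.exp (γ - β) :=
      mul_lt_mul' h2 h1 (Real.exp_pos _).le h3
    rw [hD0, e1, e2]
    refine div_pos ?_ (by positivity)
    linarith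
  -- the explicit solution
  have tden : Tendsto (fun n : ℕ => 1 + κ n * ((1 + ρ n) / (1 - ρ n))) atTop
      (𝓝 (γ ^ 2 / β ^ 2)) := by
    have := ((tκ.mul (tρ.const_add 1)).div t4 hβ.ne').const_add 1
    have e : 1 + (γ ^ 2 - β ^ 2) / (2 * β) * (1 + 1) / β = γ ^ 2 / β ^ 2 := by field_simp; ring
    rw [e] at this
    refine this.congr' ?_
    filter_upwards [eventually_gt_atTop 0] with n hn
    have hn' : (n : ℝ) ≠ 0 := by exact_mod_cast hn.ne'
    simp only [Pi.div_apply]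
    rw [mul_assoc, mul_div_mul_left _ _ hn', mul_div_assoc]
  set a : ℕ → ℝ := fun n => (1 + κ n * ((1 + ρ n) / (1 - ρ n)))⁻¹ with ha
  have ta : Tendsto a atTop (𝓝 (β ^ 2 / γ ^ 2)) := by
    have := tden.inv₀ (by positivity)
    rwa [inv_div] at this
  have tw : Tendsto (fun n : ℕ => 1 / ((n : ℝ) * (x n - ρ n)) -
      Real.exp γ / ((n : ℝ) * (ρ n * x n - 1))) atTop
      (𝓝 (1 / (γ + β) - Real.exp γ / (γ - β))) :=
    (tendsto_const_nhds.div t1 (by positivity)).sub (tendsto_const_nhds.div t2 hsub.ne')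
  have hw0 : 1 / (γ + β) - Real.exp γ / (γ - β) < 0 := by
    rw [sub_neg, div_lt_div_iff₀ (by positivity) hsub]
    have : 1 < Real.exp γ := Real.one_lt_exp_iff.2 hγ0
    nlinarith
  set b : ℕ → ℝ := fun n => -(a n / ((n : ℝ) * (1 - ρ n))) /
    (1 / ((n : ℝ) * (x n - ρ n)) - Real.exp γ / ((n : ℝ) * (ρ n * x n - 1))) with hb
  have tb : Tendsto b atTop (𝓝 (-(β ^ 2 / γ ^ 2 / β) /
      (1 / (γ + β) - Real.exp γ / (γ - β)))) :=
    ((ta.div t4 hβ.ne').neg).div tw hw0.ne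
  refine ⟨κ, ?_, tκ, ?_⟩
  · filter_upwards [hρ1, hx1, hρx1] with n h1 h2 h3
    have h4 : 0 < ρ n := Real.exp_pos _
    have : 0 ≤ 1 - ρ n ^ 2 := by nlinarith
    exact div_nonneg (mul_nonneg (by linarith) (by linarith)) (mul_nonneg (by linarith) this)
  · rw [← fredholmDetReal_eq hβ hγ, ← hD0]
    have tq : Tendsto (fun n : ℕ => a n + 2 * b n * (Real.exp γ - 1) / ((n : ℝ) * (x n - 1)))
        atTop (𝓝 (β ^ 2 / γ ^ 2 + 2 * (-(β ^ 2 / γ ^ 2 / β) /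
          (1 / (γ + β) - Real.exp γ / (γ - β))) * (Real.exp γ - 1) / γ)) :=
      ta.add (((tb.const_mul 2).mul_const _).div t6 hγ0.ne')
    refine (tD.mul tq).congr' ?_
    filter_upwards [eventually_gt_atTop 0, hκeq, hρ1, hx1, hρx1, tden.eventually_ne
      (by positivity), tD.eventually_ne hD0pos.ne', tw.eventually_ne hw0.ne]
      with n hn hk h1 h2 h3 hden hdet hw
    have hn' : (n : ℝ) ≠ 0 := by exact_mod_cast hn.ne'
    have d1 : x n - ρ n ≠ 0 := by linarith
    have d2 : 1 - ρ n * x n ≠ 0 := by linarith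
    have d2' : ρ n * x n - 1 ≠ 0 := by linarith
    have d3 : 1 - ρ n ≠ 0 := by linarith
    have hxn : x n ^ n = Real.exp γ := hpown γ n hn
    have hsol := one_add_corr_mulVec_eq_one (ρ := ρ n) (x := x n) (κ := κ n) (a := a n) (b := b n)
      (n := n) h1.ne (by linarith) h3.ne' hk (inv_mul_cancel₀ hden) (by
        rw [hxn]
        have e1 : 1 / ((n : ℝ) * (x n - ρ n)) - Real.exp γ / ((n : ℝ) * (ρ n * x n - 1))
            = (n : ℝ)⁻¹ * (1 / (x n - ρ n) + Real.exp γ / (1 - ρ n * x n)) := by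
          have : 1 - ρ n * x n = -(ρ n * x n - 1) := by ring
          rw [this, div_neg]
          field_simp
          ring
        simp only [hb]
        rw [e1] at hw ⊢
        have hw2 := right_ne_zero_of_mul hw
        generalize 1 / (x n - ρ n) + Real.exp γ / (1 - ρ n * x n) = W at *
        field_simp
        ring)
    have hdet' := det_one_add_centering_mul hn hdet hsol
    change _ = (1 + centering n * (κ n • corr (ρ n) n)).det
    rw [hdet']
    congr 1
    have g : (∑ j ∈ Finset.range n, x n ^ j) = (Real.exp γ - 1) / (x n - 1) := by
      rw [geom_sum_eq h2.ne', hxn]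
    have s1 : ∑ i : Fin n, x n ^ (i : ℕ) = (Real.exp γ - 1) / (x n - 1) := by
      rw [← g, Finset.sum_range]
    have s2 : ∑ i : Fin n, x n ^ (n - 1 - (i : ℕ)) = (Real.exp γ - 1) / (x n - 1) := by
      rw [← g, ← Finset.sum_range_reflect, Finset.sum_range]
    rw [Finset.sum_add_distrib, ← Finset.mul_sum, Finset.sum_add_distrib, s1, s2]
    simp only [Finset.sum_const, Finset.card_univ, Fintype.card_fin, nsmul_eq_mul]
    have d4 : x n - 1 ≠ 0 := by linarith
    field_simp
    ring

end AutoregressiveMatrix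

/-! ### Comparison of variances, and sampling on a grid. -/

namespace SmallBall

section Variance

variable {α : Type*} [MeasurableSpace α] {μ : Measure α} [IsProbabilityMeasure μ] {f g : α → ℝ}

lemma variance_linearCombination (hf : MemLp f 2 μ) (hg : MemLp g 2 μ) (a b : ℝ) :
    Var[fun x => a * f x + b * g x; μ] = a ^ 2 * Var[f; μ] + 2 * (a * b) * cov[f, g; μ]
      + b ^ 2 * Var[g; μ] := by
  rw [variance_fun_add (hf.const_mul a) (hg.const_mul b), variance_const_mul, variance_const_mul,
    covariance_const_mul_left, covariance_const_mul_right]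
  ring

/-- Comparison of the variances of two functions that are close in `L²`. -/
lemma abs_variance_sub_variance_le (hf : MemLp f 2 μ) (hg : MemLp g 2 μ) {c : ℝ} (hc : 0 < c) :
    |Var[f; μ] - Var[g; μ]| ≤ c / 2 * ∫ x, (f x - g x) ^ 2 ∂μ
      + c⁻¹ * (∫ x, f x ^ 2 ∂μ + ∫ x, g x ^ 2 ∂μ) := by
  -- The two combinations are `c(f - g) ± (f + g)`. Nonnegativity of their variances is the weighted
  -- Young inequality for `cov(f - g, f + g) = Var f - Var g`.
  have h1 := variance_nonneg (fun x => (c + 1) * f x + (1 - c) * g x) μ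
  have h2 := variance_nonneg (fun x => (c - 1) * f x + (-1 - c) * g x) μ
  have h3 : Var[fun x => 1 * f x + (-1) * g x; μ] ≤ ∫ x, (f x - g x) ^ 2 ∂μ := by
    refine (variance_le_expectation_sq ?_).trans (le_of_eq ?_)
    · exact ((hf.const_mul 1).add (hg.const_mul (-1))).aestronglyMeasurable
    · congr 1; ext x; simp only [Pi.pow_apply]; ring
  have h4 : Var[fun x => 1 * f x + 1 * g x; μ] ≤ 2 * (∫ x, f x ^ 2 ∂μ + ∫ x, g x ^ 2 ∂μ) := by
    refine (variance_le_expectation_sq ?_).trans ?_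
    · exact ((hf.const_mul 1).add (hg.const_mul 1)).aestronglyMeasurable
    · rw [← integral_add hf.integrable_sq hg.integrable_sq, ← integral_const_mul]
      refine integral_mono ((hf.const_mul 1).add (hg.const_mul 1)).integrable_sq
        ((hf.integrable_sq.add hg.integrable_sq).const_mul 2) fun x => ?_
      simp only [Pi.pow_apply, one_mul]
      nlinarith [sq_nonneg (f x - g x)]
  rw [variance_linearCombination hf hg] at h1 h2 h3 h4
  generalize Var[f; μ] = A at *
  generalize Var[g; μ] = B at *
  generalize cov[f, g; μ] = C at *
  generalize ∫ x, (f x - g x) ^ 2 ∂μ = D at *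
  generalize ∫ x, f x ^ 2 ∂μ + ∫ x, g x ^ 2 ∂μ = E at *
  have key : c / 2 * D + c⁻¹ * E = (c ^ 2 * D + 2 * E) / (2 * c) := by field_simp
  have hc2 := mul_le_mul_of_nonneg_left h3 (sq_nonneg c)
  rw [key, abs_le, ← neg_div, div_le_iff₀ (by positivity), le_div_iff₀ (by positivity)]
  constructor <;> nlinarith

end Variance

/-- Integral over `[0,1]` of a step function on the grid of mesh `1/n`. -/
lemma integral_floor (φ : ℕ → ℝ) {n : ℕ} (hn : 0 < n) :
    ∫ t : I, φ ⌊(n : ℝ) * t⌋₊ = (n : ℝ)⁻¹ * ∑ k ∈ Finset.range n, φ k := by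
  have hn' : (0 : ℝ) < n := by exact_mod_cast hn
  have hsub : ∫ t : I, φ ⌊(n : ℝ) * t⌋₊ = ∫ t in (0 : ℝ)..1, φ ⌊(n : ℝ) * t⌋₊ := by
    rw [intervalIntegral.integral_of_le zero_le_one, ← integral_Icc_eq_integral_Ioc]
    exact integral_subtype (s := Set.Icc (0 : ℝ) 1) measurableSet_Icc
      (fun t : ℝ => φ ⌊(n : ℝ) * t⌋₊)
  have hpiece : ∀ k : ℕ, Set.EqOn (fun t : ℝ => φ ⌊(n : ℝ) * t⌋₊) (fun _ => φ k)
      (Set.Ioo ((k : ℝ) / n) ((k + 1 : ℕ) / n)) := by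
    intro k t ht
    have h1 : (k : ℝ) ≤ n * t := by
      have := ht.1; rw [div_lt_iff₀ hn'] at this; linarith
    have h2 : (n : ℝ) * t < k + 1 := by
      have := ht.2; rw [lt_div_iff₀ hn'] at this; push_cast at this; linarith
    have : ⌊(n : ℝ) * t⌋₊ = k := by
      rw [Nat.floor_eq_iff (le_trans (by positivity) h1)]; exact ⟨h1, h2⟩
    simp only [this]
  have hle : ∀ k : ℕ, (k : ℝ) / n ≤ ((k + 1 : ℕ) : ℝ) / n := fun k => by
    gcongr; simp
  have hae : ∀ k : ℕ, (fun t : ℝ => φ ⌊(n : ℝ) * t⌋₊)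
      =ᵐ[volume.restrict (Set.uIoc ((k : ℝ) / n) ((k + 1 : ℕ) / n))] fun _ => φ k := by
    intro k
    rw [Set.uIoc_of_le (hle k), ← restrict_Ioo_eq_restrict_Ioc]
    exact (ae_restrict_iff' measurableSet_Ioo).2 (Eventually.of_forall fun t ht => hpiece k ht)
  have hint : ∀ k < n, IntervalIntegrable (fun t : ℝ => φ ⌊(n : ℝ) * t⌋₊) volume
      ((k : ℝ) / n) ((k + 1 : ℕ) / n) := fun k _ =>
    (intervalIntegrable_const (c := φ k)).congr_ae (hae k).symm
  have hs := intervalIntegral.sum_integral_adjacent_intervals (a := fun k : ℕ => (k : ℝ) / n) hint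
  simp only [Nat.cast_zero, zero_div, div_self hn'.ne'] at hs
  rw [hsub, ← hs, Finset.mul_sum]
  refine Finset.sum_congr rfl fun k _ => ?_
  rw [intervalIntegral.integral_congr_ae_restrict (hae k), intervalIntegral.integral_const,
    smul_eq_mul]
  push_cast
  field_simp
  ring

/-- The grid point `k/n`. -/
noncomputable def grid (n k : ℕ) : I := Set.projIcc 0 1 zero_le_one ((k : ℝ) / n)

lemma coe_grid {n k : ℕ} (hn : 0 < n) (hk : k ≤ n) : (grid n k : ℝ) = k / n := by
  have hn' : (0 : ℝ) < n := by exact_mod_cast hn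
  rw [grid, Set.projIcc_of_mem zero_le_one (x := (k : ℝ) / n)]
  exact ⟨by positivity, by rw [div_le_one hn']; exact_mod_cast hk⟩

lemma abs_sub_grid_floor_le {n : ℕ} (hn : 0 < n) (t : I) :
    |(t : ℝ) - grid n ⌊(n : ℝ) * t⌋₊| ≤ (n : ℝ)⁻¹ := by
  have hn' : (0 : ℝ) < n := by exact_mod_cast hn
  have hnt : (0 : ℝ) ≤ n * t := mul_nonneg hn'.le t.2.1
  have hk : ⌊(n : ℝ) * t⌋₊ ≤ n := by
    apply Nat.floor_le_of_le
    nlinarith [t.2.2]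
  rw [coe_grid hn hk, abs_le]
  have h1 := Nat.floor_le hnt
  have h2 := Nat.lt_floor_add_one ((n : ℝ) * t)
  have e : (t : ℝ) = (n * t) / n := by field_simp
  constructor
  · rw [neg_le_sub_iff_le_add, div_le_iff₀ hn', add_mul, inv_mul_cancel₀ hn'.ne']; nlinarith
  · rw [sub_le_iff_le_add, inv_eq_one_div, ← add_div, le_div_iff₀ hn']; nlinarith

variable {Ω : Type*} [MeasurableSpace Ω] {P : Measure Ω} {β : ℝ} {U : I → Ω → ℝ}

lemma memLp_two (hU : IsOrnsteinUhlenbeck β U P) (t : I) : MemLp (U t) 2 P :=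
  (hU.isGaussianProcess.hasGaussianLaw_eval t).memLp_two

lemma integral_sq (hU : IsOrnsteinUhlenbeck β U P) (t : I) : ∫ ω, U t ω ^ 2 ∂P = 1 / (2 * β) := by
  have := hU.covariance t t
  simpa [sq] using this

/-- The left side equals `(1 - exp(-β|t-s|))/β`, and `1 - exp(-x) ≤ x`. -/
lemma integral_sub_sq_le (hU : IsOrnsteinUhlenbeck β U P) (hβ : 0 < β) (t s : I) :
    ∫ ω, (U t ω - U s ω) ^ 2 ∂P ≤ |(t : ℝ) - s| := by
  have ht := memLp_two hU t
  have hs := memLp_two hU s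
  have e : ∀ ω, (U t ω - U s ω) ^ 2 = U t ω ^ 2 - 2 * (U t ω * U s ω) + U s ω ^ 2 := fun ω => by
    ring
  have hts : Integrable (fun ω => U t ω * U s ω) P := ht.integrable_mul hs
  have hd : Integrable (fun ω => U t ω ^ 2 - 2 * (U t ω * U s ω)) P :=
    ht.integrable_sq.sub (hts.const_mul 2)
  simp_rw [e]
  rw [integral_add hd hs.integrable_sq,
    integral_sub ht.integrable_sq (hts.const_mul 2), integral_const_mul, integral_sq hU,
    integral_sq hU, hU.covariance]
  have := Real.add_one_le_exp (-β * |(t : ℝ) - s|)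
  generalize Real.exp (-β * |(t : ℝ) - s|) = E at *
  have h2 : 1 - E ≤ β * |(t : ℝ) - s| := by linarith
  have : 1 / (2 * β) - 2 * (1 / (2 * β) * E) + 1 / (2 * β) = (1 - E) / β := by field_simp; ring
  rw [this, div_le_iff₀ hβ]
  linarith

end SmallBall

/-! ### Laplace transform of the path variance, by passage to the limit from the grid. -/

namespace SmallBall

variable {Ω : Type*} [MeasurableSpace Ω] {P : Measure Ω} {β : ℝ}
  {U : I → Ω → ℝ}

/-- A jointly measurable process whose second moments are bounded is square integrable for the
product measure. -/
lemma memLp_two_uncurry [IsProbabilityMeasure P] {V : I → Ω → ℝ}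
    (hm : AEMeasurable (Function.uncurry V) ((volume : Measure I).prod P))
    (h2 : ∀ t, MemLp (V t) 2 P) {C : ℝ} (hC : ∀ t, ∫ ω, V t ω ^ 2 ∂P = C) :
    MemLp (Function.uncurry V) 2 ((volume : Measure I).prod P) := by
  rw [memLp_two_iff_integrable_sq hm.aestronglyMeasurable,
    integrable_prod_iff (hm.pow_const 2).aestronglyMeasurable]
  refine ⟨Eventually.of_forall fun t => (h2 t).integrable_sq, ?_⟩
  simp only [Function.uncurry_apply_pair, norm_pow, Real.norm_eq_abs, sq_abs, hC]
  exact integrable_const _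

/-- The step process that samples `U` on the grid of mesh `1/n`. -/
noncomputable def sampled (U : I → Ω → ℝ) (n : ℕ) : I → Ω → ℝ :=
  fun t => U (grid n ⌊(n : ℝ) * t⌋₊)

/-- Each `U t` is only almost everywhere measurable. Only countably many grid points occur, so
measurable versions can be chosen for all of them outside one null set. -/
lemma aemeasurable_sampled (hU : IsOrnsteinUhlenbeck β U P) (n : ℕ) :
    AEMeasurable (Function.uncurry (sampled U n)) ((volume : Measure I).prod P) := by
  have hk : ∀ k, ∃ V : Ω → ℝ, Measurable V ∧ U (grid n k) =ᵐ[P] V :=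
    fun k => hU.isGaussianProcess.aemeasurable _
  choose V hVm hVe using hk
  have h1 : Measurable fun r : ℕ × Ω => V r.1 r.2 :=
    measurable_from_prod_countable_right hVm
  have h2 : Measurable fun q : I × Ω => (⌊(n : ℝ) * q.1⌋₊, q.2) := by fun_prop
  have h3 : Measurable fun q : I × Ω => V ⌊(n : ℝ) * q.1⌋₊ q.2 := h1.comp h2
  refine ⟨_, h3, ?_⟩
  have h4 : ∀ᵐ ω ∂P, ∀ k, U (grid n k) ω = V k ω := ae_all_iff.2 hVe
  have h5 : ∀ᵐ q ∂((volume : Measure I).prod P), ∀ k, U (grid n k) q.2 = V k q.2 :=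
    Measure.quasiMeasurePreserving_snd.ae h4
  filter_upwards [h5] with q hq
  exact hq _

lemma memLp_path [IsProbabilityMeasure P] {V : I → Ω → ℝ}
    (h : MemLp (Function.uncurry V) 2 ((volume : Measure I).prod P)) :
    ∀ᵐ ω ∂P, MemLp (fun t => V t ω) 2 volume := by
  have h1 := h.aestronglyMeasurable.prodMk_right
  have h2 := ((memLp_two_iff_integrable_sq h.aestronglyMeasurable).1 h).prod_left_ae
  filter_upwards [h1, h2] with ω hω1 hω2
  exact (memLp_two_iff_integrable_sq hω1).2 hω2

lemma integral_integral_sq [IsProbabilityMeasure P] {V : I → Ω → ℝ}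
    (h : MemLp (Function.uncurry V) 2 ((volume : Measure I).prod P)) :
    ∫ ω, (∫ t, V t ω ^ 2) ∂P = ∫ t, ∫ ω, V t ω ^ 2 ∂P :=
  (integral_integral_swap (f := fun t ω => V t ω ^ 2) h.integrable_sq).symm

lemma integrable_variance_path [IsProbabilityMeasure P] {V : I → Ω → ℝ}
    (h : MemLp (Function.uncurry V) 2 ((volume : Measure I).prod P)) :
    Integrable (fun ω => Var[fun t => V t ω; volume]) P := by
  have h2 : Integrable (fun ω => ∫ t, V t ω ^ 2) P := h.integrable_sq.integral_prod_right
  have h1 : Integrable (fun ω => ∫ t, V t ω) P := (h.integrable one_le_two).integral_prod_right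
  have hvar : ∀ᵐ ω ∂P, Var[fun t => V t ω; volume] = (∫ t, V t ω ^ 2) - (∫ t, V t ω) ^ 2 := by
    filter_upwards [memLp_path h] with ω hω
    rw [variance_eq_sub hω]
    rfl
  have hm : AEStronglyMeasurable (fun ω => Var[fun t => V t ω; volume]) P :=
    (h2.aestronglyMeasurable.sub (h1.aestronglyMeasurable.pow 2)).congr
      (hvar.mono fun ω hω => hω.symm)
  refine h2.mono' hm ?_
  filter_upwards [memLp_path h] with ω hω
  rw [Real.norm_of_nonneg (variance_nonneg _ _)]
  exact variance_le_expectation_sq hω.aestronglyMeasurable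

lemma integral_abs_variance_sub_le [IsProbabilityMeasure P] (hβ : 0 < β)
    (hU : IsOrnsteinUhlenbeck β U P) {n : ℕ} (hn : 0 < n) :
    ∫ ω, |Var[fun t => U t ω; volume] - Var[fun t => sampled U n t ω; volume]| ∂P
      ≤ (1 / 2 + 1 / β) * (√n)⁻¹ := by
  have hn' : (0 : ℝ) < n := by exact_mod_cast hn
  have hs : 0 < √(n : ℝ) := Real.sqrt_pos.2 hn'
  have hU2 := memLp_two_uncurry hU.aemeasurable_uncurry (memLp_two hU) (integral_sq hU)
  have hV2 : MemLp (Function.uncurry (sampled U n)) 2 ((volume : Measure I).prod P) :=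
    memLp_two_uncurry (aemeasurable_sampled hU n) (fun t => memLp_two hU _)
      (fun t => integral_sq hU _)
  have hW2 : MemLp (Function.uncurry fun t ω => U t ω - sampled U n t ω) 2
      ((volume : Measure I).prod P) := hU2.sub hV2
  have i1 : Integrable (fun ω => ∫ t, U t ω ^ 2) P := hU2.integrable_sq.integral_prod_right
  have i2 : Integrable (fun ω => ∫ t, sampled U n t ω ^ 2) P :=
    hV2.integrable_sq.integral_prod_right
  have i3 : Integrable (fun ω => ∫ t, (U t ω - sampled U n t ω) ^ 2) P :=
    hW2.integrable_sq.integral_prod_right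
  have e1 : ∫ ω, (∫ t, U t ω ^ 2) ∂P = 1 / (2 * β) := by
    rw [integral_integral_sq hU2]; simp [integral_sq hU]
  have e2 : ∫ ω, (∫ t, sampled U n t ω ^ 2) ∂P = 1 / (2 * β) := by
    rw [integral_integral_sq hV2]; simp [sampled, integral_sq hU]
  have e3 : ∫ ω, (∫ t, (U t ω - sampled U n t ω) ^ 2) ∂P ≤ (n : ℝ)⁻¹ := by
    rw [integral_integral_sq hW2]
    have hb : ∀ t, ∫ ω, (U t ω - sampled U n t ω) ^ 2 ∂P ≤ (n : ℝ)⁻¹ := fun t =>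
      (integral_sub_sq_le hU hβ t _).trans (abs_sub_grid_floor_le hn t)
    have := integral_mono (μ := (volume : Measure I)) hW2.integrable_sq.integral_prod_left
      (integrable_const ((n : ℝ)⁻¹)) hb
    simpa using this
  have hle : ∀ᵐ ω ∂P, |Var[fun t => U t ω; volume] - Var[fun t => sampled U n t ω; volume]| ≤
      √n / 2 * (∫ t, (U t ω - sampled U n t ω) ^ 2)
        + (√n)⁻¹ * ((∫ t, U t ω ^ 2) + ∫ t, sampled U n t ω ^ 2) := by
    filter_upwards [memLp_path hU2, memLp_path hV2] with ω h1 h2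
    -- The weight `c = √n` balances a mean squared error of order `1/n` against bounded second
    -- moments, so both terms are of order `1/√n`.
    exact abs_variance_sub_variance_le h1 h2 hs
  have i12 : Integrable (fun ω => (√n)⁻¹ * ((∫ t, U t ω ^ 2) + ∫ t, sampled U n t ω ^ 2)) P :=
    (i1.add i2).const_mul _
  refine (integral_mono_ae ((integrable_variance_path hU2).sub
    (integrable_variance_path hV2)).abs ((i3.const_mul (√n / 2)).add i12) hle).trans ?_
  simp only [Pi.add_apply]
  rw [integral_add (i3.const_mul _) i12, integral_const_mul, integral_const_mul,
    integral_add i1 i2, e1, e2]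
  have hsq : √(n : ℝ) * √n = n := Real.mul_self_sqrt hn'.le
  calc √n / 2 * (∫ ω, (∫ t, (U t ω - sampled U n t ω) ^ 2) ∂P) + (√n)⁻¹ * (1 / (2 * β) + 1 / (2 * β))
      ≤ √n / 2 * (n : ℝ)⁻¹ + (√n)⁻¹ * (1 / (2 * β) + 1 / (2 * β)) := by gcongr
    _ = (1 / 2 + 1 / β) * (√n)⁻¹ := by
      have h : √(n : ℝ) * (n : ℝ)⁻¹ = (√n)⁻¹ := by
        nth_rewrite 2 [← hsq]
        field_simp
      rw [div_mul_eq_mul_div, h]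
      field_simp
      ring

open Matrix in
/-- The Laplace transform of the sampled process is a finite determinant. -/
lemma integral_exp_variance_sampled (hβ : 0 < β) (hU : IsOrnsteinUhlenbeck β U P) {n : ℕ}
    (hn : 0 < n) {κ : ℝ} (hκ : 0 ≤ κ) :
    (∫ ω, Real.exp (-(β * (n * κ) * Var[fun t => sampled U n t ω; volume])) ∂P) ^ 2 *
      (1 + AutoregressiveMatrix.centering n *
        (κ • AutoregressiveMatrix.corr (Real.exp (-β / n)) n)).det = 1 := by
  have hn' : (0 : ℝ) < n := by exact_mod_cast hn
  set X : Fin n → Ω → ℝ := fun i => U (grid n i) with hX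
  have hG : HasGaussianLaw (fun ω i => X i ω) P := by
    let L : ((Finset.univ.image fun i : Fin n => grid n i) → ℝ) →L[ℝ] (Fin n → ℝ) :=
      ContinuousLinearMap.pi fun i => ContinuousLinearMap.proj
        ⟨grid n i, Finset.mem_image_of_mem _ (Finset.mem_univ i)⟩
    exact (hU.isGaussianProcess.hasGaussianLaw (Finset.univ.image fun i : Fin n => grid n i)).map L
  have hK : ∀ i j, ∫ ω, X i ω * X j ω ∂P =
      ((1 / (2 * β)) • AutoregressiveMatrix.corr (Real.exp (-β / n)) n) i j := by
    intro i j
    rw [hX, hU.covariance, coe_grid hn i.2.le, coe_grid hn j.2.le]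
    simp only [AutoregressiveMatrix.corr, Matrix.smul_apply, Matrix.of_apply, smul_eq_mul]
    congr 1
    rw [← Real.exp_nat_mul]
    congr 1
    have : |((i : ℕ) : ℝ) / n - ((j : ℕ) : ℝ) / n|
        = (((i : ℕ) - (j : ℕ) + ((j : ℕ) - (i : ℕ)) : ℕ) : ℝ) / n := by
      rw [← sub_div, abs_div, abs_of_pos hn']
      congr 1
      rcases le_total (i : ℕ) (j : ℕ) with h | h
      · have hr : ((i : ℕ) : ℝ) ≤ ((j : ℕ) : ℝ) := by exact_mod_cast h
        rw [abs_of_nonpos (by linarith), Nat.sub_eq_zero_of_le h, zero_add, Nat.cast_sub h]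
        ring
      · have hr : ((j : ℕ) : ℝ) ≤ ((i : ℕ) : ℝ) := by exact_mod_cast h
        rw [abs_of_nonneg (by linarith), Nat.sub_eq_zero_of_le h, add_zero, Nat.cast_sub h]
    rw [this]
    ring
  -- The factor `β κ` is chosen to offset the covariance factor `1/(2β)` and the `2` in the
  -- determinant, leaving exactly `κ`.
  have hM : ((β * κ) • AutoregressiveMatrix.centering n).PosSemidef :=
    (AutoregressiveMatrix.posSemidef_centering n).smul (by positivity)
  have key := GaussianQuadForm.integral_exp_neg_quadForm hG (fun i => hU.mean_zero _) hK hM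
  have hdet : (2 : ℝ) • (((β * κ) • AutoregressiveMatrix.centering n) *
      ((1 / (2 * β)) • AutoregressiveMatrix.corr (Real.exp (-β / n)) n))
      = AutoregressiveMatrix.centering n *
        (κ • AutoregressiveMatrix.corr (Real.exp (-β / n)) n) := by
    rw [Matrix.smul_mul, Matrix.mul_smul, Matrix.mul_smul, smul_smul, smul_smul]
    congr 1
    field_simp
  rw [hdet] at key
  rw [← key]
  congr 3
  ext ω
  congr 2
  have hmem : MemLp (fun t => sampled U n t ω) 2 (volume : Measure I) := by
    refine MemLp.of_bound (C := ∑ k ∈ Finset.range (n + 1), |U (grid n k) ω|) ?_ ?_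
    · have : Measurable fun k : ℕ => U (grid n k) ω := measurable_from_top
      exact (this.comp (by fun_prop : Measurable fun t : I => ⌊(n : ℝ) * t⌋₊)).aestronglyMeasurable
    · refine Eventually.of_forall fun t => ?_
      have hk : ⌊(n : ℝ) * t⌋₊ ∈ Finset.range (n + 1) := by
        rw [Finset.mem_range, Nat.lt_succ_iff]
        apply Nat.floor_le_of_le
        nlinarith [t.2.2]
      exact Finset.single_le_sum (f := fun k => |U (grid n k) ω|) (fun _ _ => abs_nonneg _) hk
  rw [variance_eq_sub hmem, Matrix.smul_mulVec, dotProduct_smul,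
    AutoregressiveMatrix.centering_quadForm]
  have s1 := integral_floor (fun k => U (grid n k) ω ^ 2) hn
  have s2 := integral_floor (fun k => U (grid n k) ω) hn
  simp only [sampled, Pi.pow_apply]
  rw [s1, s2, Finset.sum_range, Finset.sum_range, smul_eq_mul]
  simp only [hX]
  field_simp

lemma abs_exp_neg_sub_exp_neg_le {a b : ℝ} (ha : 0 ≤ a) (hb : 0 ≤ b) :
    |Real.exp (-a) - Real.exp (-b)| ≤ |a - b| := by
  wlog h : a ≤ b generalizing a b
  · rw [abs_sub_comm, abs_sub_comm a]; exact this hb ha (not_le.1 h).le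
  have h1 : Real.exp (-b) ≤ Real.exp (-a) := Real.exp_le_exp.2 (by linarith)
  rw [abs_of_nonneg (by linarith), abs_of_nonpos (by linarith)]
  have h2 : Real.exp (-b) = Real.exp (-a) * Real.exp (a - b) := by
    rw [← Real.exp_add]; congr 1; ring
  have h3 := Real.add_one_le_exp (a - b)
  have h4 : Real.exp (-a) ≤ 1 := Real.exp_le_one_iff.2 (by linarith)
  have h5 : 0 < Real.exp (-a) := Real.exp_pos _
  nlinarith

/-- Laplace transform of the squared `L₂` norm of the demeaned Ornstein-Uhlenbeck process. -/
theorem laplace_variance [IsProbabilityMeasure P] (hβ : 0 < β)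
    (hU : IsOrnsteinUhlenbeck β U P) {s : ℝ} (hs : 0 < s) :
    (∫ ω, Real.exp (-s * Var[fun t => U t ω; volume]) ∂P) ^ 2 *
      fredholmDetReal β √(2 * s + β ^ 2) = 1 := by
  set γ := √(2 * s + β ^ 2) with hγdef
  have hγ2 : γ ^ 2 = 2 * s + β ^ 2 := Real.sq_sqrt (by positivity)
  have hγ : β < γ := Real.lt_sqrt_of_sq_lt (by linarith)
  obtain ⟨κ, hκ0, hκ, hdet⟩ := AutoregressiveMatrix.exists_weights hβ hγ
  have ha : Tendsto (fun n : ℕ => β * (n * κ n)) atTop (𝓝 s) := by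
    have := hκ.const_mul β
    have e : β * ((γ ^ 2 - β ^ 2) / (2 * β)) = s := by rw [hγ2]; field_simp; ring
    rwa [e] at this
  have hU2 := memLp_two_uncurry hU.aemeasurable_uncurry (memLp_two hU) (integral_sq hU)
  have hV2 : ∀ n, MemLp (Function.uncurry (sampled U n)) 2 ((volume : Measure I).prod P) := fun n =>
    memLp_two_uncurry (aemeasurable_sampled hU n) (fun t => memLp_two hU _)
      (fun t => integral_sq hU _)
  have iS := integrable_variance_path hU2
  set S : Ω → ℝ := fun ω => Var[fun t => U t ω; volume] with hS
  have iT := fun n => integrable_variance_path (hV2 n)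
  set T : ℕ → Ω → ℝ := fun n ω => Var[fun t => sampled U n t ω; volume] with hT
  have hS0 : ∀ ω, 0 ≤ S ω := fun ω => variance_nonneg _ _
  have hT0 : ∀ n ω, 0 ≤ T n ω := fun n ω => variance_nonneg _ _
  have hexpi : ∀ (X : Ω → ℝ), Integrable X P → (∀ ω, 0 ≤ X ω) →
      Integrable (fun ω => Real.exp (-X ω)) P := by
    intro X hX hX0
    refine (integrable_const (1 : ℝ)).mono' ?_ (Eventually.of_forall fun ω => ?_)
    · exact (Real.measurable_exp.comp_aemeasurable hX.aemeasurable.neg).aestronglyMeasurable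
    · rw [Real.norm_of_nonneg (Real.exp_pos _).le, Real.exp_le_one_iff]
      linarith [hX0 ω]
  have hlim : Tendsto (fun n : ℕ => ∫ ω, Real.exp (-(β * (n * κ n) * T n ω)) ∂P) atTop
      (𝓝 (∫ ω, Real.exp (-(s * S ω)) ∂P)) := by
    rw [tendsto_iff_dist_tendsto_zero]
    -- Two errors are controlled: replacing the path by its samples, and using the weight `β n κ n`
    -- in place of its limit `s`.
    have hb0 : Tendsto (fun n : ℕ => β * (n * κ n) * ((1 / 2 + 1 / β) * (√n)⁻¹) +
        |β * (n * κ n) - s| * ∫ ω, S ω ∂P) atTop (𝓝 0) := by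
      have h1 : Tendsto (fun n : ℕ => (√(n : ℝ))⁻¹) atTop (𝓝 0) :=
        (Real.tendsto_sqrt_atTop.comp tendsto_natCast_atTop_atTop).inv_tendsto_atTop
      have h2 := (ha.mul (h1.const_mul (1 / 2 + 1 / β))).add
        (((ha.sub_const s).abs).mul_const (∫ ω, S ω ∂P))
      simpa using h2
    refine squeeze_zero' (Eventually.of_forall fun _ => dist_nonneg) ?_ hb0
    filter_upwards [hκ0, eventually_gt_atTop 0] with n hn0 hn
    set a := β * (n * κ n) with ha'
    have ha0 : 0 ≤ a := by positivity
    rw [Real.dist_eq, ← integral_sub (hexpi _ ((iT n).const_mul a)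
      fun ω => mul_nonneg ha0 (hT0 n ω)) (hexpi _ (iS.const_mul s)
      fun ω => mul_nonneg hs.le (hS0 ω))]
    have iST : Integrable (fun ω => |S ω - T n ω|) P := (iS.sub (iT n)).abs
    calc |∫ ω, (Real.exp (-(a * T n ω)) - Real.exp (-(s * S ω))) ∂P|
        ≤ ∫ ω, (a * |S ω - T n ω| + |a - s| * S ω) ∂P := by
          rw [← Real.norm_eq_abs]
          refine norm_integral_le_of_norm_le ((iST.const_mul a).add (iS.const_mul |a - s|))
            (Eventually.of_forall fun ω => ?_)
          rw [Real.norm_eq_abs]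
          refine (abs_exp_neg_sub_exp_neg_le (mul_nonneg ha0 (hT0 n ω))
            (mul_nonneg hs.le (hS0 ω))).trans ?_
          have e : a * T n ω - s * S ω = -(a * (S ω - T n ω)) + (a - s) * S ω := by ring
          rw [e]
          refine (abs_add_le _ _).trans ?_
          rw [abs_neg, abs_mul a (S ω - T n ω), abs_mul (a - s) (S ω),
            abs_of_nonneg ha0, abs_of_nonneg (hS0 ω)]
      _ = a * (∫ ω, |S ω - T n ω| ∂P) + |a - s| * ∫ ω, S ω ∂P := by
          rw [integral_add (iST.const_mul a) (iS.const_mul _), integral_const_mul,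
            integral_const_mul]
      _ ≤ _ := by
          gcongr
          exact integral_abs_variance_sub_le hβ hU hn
  have hprod := (hlim.pow 2).mul hdet
  have hone : Tendsto (fun n : ℕ => (∫ ω, Real.exp (-(β * (n * κ n) * T n ω)) ∂P) ^ 2 *
      (1 + AutoregressiveMatrix.centering n *
        (κ n • AutoregressiveMatrix.corr (Real.exp (-β / n)) n)).det) atTop (𝓝 1) := by
    refine tendsto_const_nhds.congr' ?_
    filter_upwards [hκ0, eventually_gt_atTop 0] with n hn0 hn
    exact (integral_exp_variance_sampled hβ hU hn hn0).symm
  have := tendsto_nhds_unique hprod hone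
  simpa only [neg_mul] using this

/-- The squared `L₂` norm of the demeaned path is the variance of `t ↦ U t ω` under the uniform law.
Square integrability ensures that the real-valued variance agrees with the extended one. -/
lemma pathNorm_demeaned_le_iff {Ω : Type*} {U : I → Ω → ℝ} {ω : Ω}
    (h : MemLp (fun t => U t ω) 2 volume) {ε : ℝ} (hε : 0 ≤ ε) :
    pathNorm (demeaned U) ω ≤ ENNReal.ofReal ε ↔ Var[fun t => U t ω; volume] ≤ ε ^ 2 := by
  have h1 : pathNorm (demeaned U) ω ^ 2 = ENNReal.ofReal Var[fun t => U t ω; volume] := by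
    rw [ofReal_variance h, pathNorm]
    have h2 := eLpNorm_nnreal_pow_eq_lintegral (μ := (volume : Measure I)) (p := 2)
      (f := fun t => demeaned U t ω) two_ne_zero
    simp only [NNReal.coe_ofNat, ENNReal.coe_ofNat, ENNReal.rpow_ofNat] at h2
    exact h2
  rw [← ENNReal.pow_le_pow_left_iff two_ne_zero, h1, ← ENNReal.ofReal_pow hε,
    ENNReal.ofReal_le_ofReal_iff (by positivity)]

end SmallBall

theorem mainTheorem4 {Ω : Type*} [MeasurableSpace Ω] (P : Measure Ω) [IsProbabilityMeasure P]
    (β : ℝ) (hβ : 0 < β) (U : I → Ω → ℝ) (hU : IsOrnsteinUhlenbeck β U P) :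
    (fun ε : ℝ => P.real {ω | pathNorm (demeaned U) ω ≤ ENNReal.ofReal ε})
      ~[𝓝[>] (0 : ℝ)]
    (fun ε : ℝ => (16 * Real.exp β / (Real.pi * (2 + β))) ^ (1 / 2 : ℝ) *
      Real.exp (-(1 / 8) * (ε ^ 2)⁻¹)) := by
  have hU2 := SmallBall.memLp_two_uncurry hU.aemeasurable_uncurry (SmallBall.memLp_two hU)
    (SmallBall.integral_sq hU)
  have hlim := SmallBall.tendsto_measure_le_mul_exp
    (SmallBall.integrable_variance_path hU2).aemeasurable
    (Eventually.of_forall fun ω => variance_nonneg _ _) hβ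
    (fun s hs => SmallBall.laplace_variance hβ hU hs)
  set A := (16 * Real.exp β / (Real.pi * (2 + β))) ^ (1 / 2 : ℝ) with hA
  have hA0 : 0 < A := Real.rpow_pos_of_pos (by positivity) _
  have hC : 2 * √(4 * Real.exp β / (2 + β)) / √Real.pi = A := by
    rw [hA, ← Real.sqrt_eq_rpow]
    have e : 16 * Real.exp β / (Real.pi * (2 + β))
        = 2 ^ 2 * (4 * Real.exp β / (2 + β)) / Real.pi := by field_simp; ring
    rw [e, Real.sqrt_div (by positivity : (0 : ℝ) ≤ 2 ^ 2 * (4 * Real.exp β / (2 + β))),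
      Real.sqrt_mul (by positivity : (0 : ℝ) ≤ 2 ^ 2), Real.sqrt_sq (by norm_num : (0 : ℝ) ≤ 2)]
  rw [hC] at hlim
  refine (isEquivalent_iff_tendsto_one (Eventually.of_forall fun ε => by positivity)).2 ?_
  have h1 := hlim.div_const A
  rw [div_self hA0.ne'] at h1
  refine h1.congr' ?_
  filter_upwards [self_mem_nhdsWithin] with ε hε
  -- The two events can differ only on the null set of paths that are not square integrable.
  have hset : P.real {ω | pathNorm (demeaned U) ω ≤ ENNReal.ofReal ε}
      = P.real {ω | Var[fun t => U t ω; volume] ≤ ε ^ 2} := by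
    refine measureReal_congr ?_
    filter_upwards [SmallBall.memLp_path hU2] with ω hω
    exact propext (SmallBall.pathNorm_demeaned_le_iff hω (le_of_lt hε))
  simp only [Pi.div_apply]
  rw [hset, neg_mul, Real.exp_neg]
  field_simp
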